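/- Let $\Omega\subset\mathbb R^n$ be a bounded Lipschitz domain, let ${\bf b}\in L_\infty(\Omega)^n$ with $\operatorname{div}{\bf b}\in L_\infty(\Omega)$ (i.e. ${\bf b}\in W^0_\infty(\operatorname{div};\Omega)$), and let $c\in L_\infty(\Omega)$, all real-valued. With ${\bf b}\cdot\nabla u:=\operatorname{div}(u{\bf b})-u\operatorname{div}{\bf b}$ in the sense of distributions, put $H({\bf b};\Omega)=\{u\in L_2(\Omega):{\bf b}\cdot\nabla u\in L_2(\Omega)\}$, with $\|u\|_{H({\bf b};\Omega)}^2=\|u\|_{L_2(\Omega)}^2+\|{\bf b}\cdot\nabla u\|_{L_2(\Omega)}^2$. Let ${\bf b}\cdot{\bf n}$ be the normal trace of ${\bf b}$ on $\partial\Omega$, given by $\int_\Omega {\bf b}\cdot\nabla\varphi+\varphi\operatorname{div}{\bf b}\,dx=\int_{\partial\Omega}\varphi\,{\bf b}\cdot{\bf n}\,ds$ for all $\varphi\in C_c^\infty(\mathbb R^n)$, let $\Gamma_\pm=\{x\in\partial\Omega:\pm({\bf b}\cdot{\bf n})(x)>0\}$ (up to null sets of $\partial\Omega$), and let $H_{0,\Gamma_\pm}({\bf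 b};\Omega)$ be the closure in $H({\bf b};\Omega)$ of $\{u\in H({\bf b};\Omega)\cap C(\bar\Omega):u=0\text{ (a.e.) on }\Gamma_\pm\}$. Assume that $$\mathcal B:H_{0,\Gamma_-}({\bf b};\Omega)\to L_2(\Omega),\ u\mapsto{\bf b}\cdot\nabla u+cu,\qquad \mathcal B^*:H_{0,\Gamma_+}({\bf b};\Omega)\to L_2(\Omega),\ v\mapsto cv-\operatorname{div}(v{\bf b})$$ are isomorphisms (bounded with bounded inverse). Let $\Omega_h$ be any partition of $\Omega$, i.e. a collection of pairwise disjoint Lipschitz domains $K$ with $\bar\Omega=\bigcup_{K\in\Omega_h}\bar K$. Let $H({\bf b};\Omega_h)=\{v\in L_2(\Omega):{\bf b}\cdot\nabla_h v\in L_2(\Omega)\}$, where $\nabla_h$ is the piecewise gradient, with $\|v\|_{H({\bf b};\Omega_h)}^2=\|v\|_{L_2(\Omega)}^2+\|{\bf b}\cdot\nabla_h v\|_{L_2(\Omega)}^2$. For $v\in H({\bf b};\Omega_h)$, $w\in H_{0,\Gamma_-}({\bf b};\Omega)$ and $K\in\Omega_h$ the boundary integral $\int_{\partial K}v\,w\,{\bf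 b}\cdot{\bf n}_K\,ds$ is understood as $\int_K({\bf b}\cdot\nabla v)w+v({\bf b}\cdot\nabla w+w\operatorname{div}{\bf b})\,dx$; the trace $w|_{\partial\Omega_h}$ on the non-characteristic part of the mesh skeleton is the class of $w$ modulo those functions for which all these integrals, for all $K$ and $v$, vanish. Let $H_{0,\Gamma_-}({\bf b};\partial\Omega_h)=\{w|_{\partial\Omega_h}:w\in H_{0,\Gamma_-}({\bf b};\Omega)\}$ with the quotient norm $\|\theta\|=\inf\{\|w\|_{H({\bf b};\Omega)}:w|_{\partial\Omega_h}=\theta\}$, and for $\theta=w|_{\partial\Omega_h}$ let $\int_{\partial\Omega_h}[\![v{\bf b}]\!]\theta\,ds=\sum_{K\in\Omega_h}\int_{\partial K}v\,w\,{\bf b}\cdot{\bf n}_K\,ds$. Put $\mathbb U=L_2(\Omega)\times H_{0,\Gamma_-}({\bf b};\partial\Omega_h)$ with $\|(u,\theta)\|_{\mathbb U}^2=\|u\|^2+\|\theta\|^2$, $\mathbb V=H({\bf b};\Omega_h)$, and $$(\mathcal B_h(u,\theta))(v)=\int_\Omega(cv-{\bf b}\cdot\nabla_hv-v\operatorname{div}{\bf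 b})\,u\,dx+\int_{\partial\Omega_h}[\![v{\bf b}]\!]\,\theta\,ds .$$ Then $\mathcal B_h:\mathbb U\to\mathbb V'$ is an isomorphism, and $$\|\mathcal B_h\|_{\mathcal L(\mathbb U,\mathbb V')}\le 2+\|\operatorname{div}{\bf b}\|_{L_\infty(\Omega)}+\|c-\operatorname{div}{\bf b}\|_{L_\infty(\Omega)},\qquad \|\mathcal B_h^{-1}\|_{\mathcal L(\mathbb V',\mathbb U)}\le\sqrt{\|(\mathcal B^*)^{-1}\|^2+\tilde C_{\mathcal B}^2},$$ where $\tilde C_{\mathcal B}=\bigl(1+\|(\mathcal B^*)^{-1}\|(1+\|c-\operatorname{div}{\bf b}\|_{L_\infty(\Omega)})\bigr)\,\|\mathcal B^{-1}\|\,(\|c-\operatorname{div}{\bf b}\|_{L_\infty(\Omega)}+1)$, and $\|\mathcal B^{-1}\|$, $\|(\mathcal B^*)^{-1}\|$ are the operator norms from $L_2(\Omega)$ to $H_{0,\Gamma_-}({\bf b};\Omega)$, $H_{0,\Gamma_+}({\bf b};\Omega)$. In particular the bounds do not depend on the partition. -/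

import Mathlib

open MeasureTheory Topology
open scoped ENNReal ContDiff

noncomputable section

namespace Transport

/-- The Euclidean space `ℝⁿ`. -/
abbrev Pt (n : ℕ) : Type := EuclideanSpace ℝ (Fin n)

variable {n : ℕ}

/-! ### Domains and partitions -/

/-- A bounded Lipschitz domain: a bounded, nonempty, connected open set that near each of its
boundary points is, in suitable orthonormal coordinates with vertical direction `e`, the part of
space above the graph of a Lipschitz function `γ` of the horizontal coordinates. -/
structure IsLipschitzDomain (Ω : Set (Pt n)) : Prop where
  isOpen : IsOpen Ω
  isBounded : Bornology.IsBounded Ω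
  isConnected : IsConnected Ω
  boundary : ∀ x ∈ frontier Ω, ∃ e : Pt n, ‖e‖ = 1 ∧
    ∃ γ : ↥(ℝ ∙ e)ᗮ → ℝ, (∃ L, LipschitzWith L γ) ∧
      ∃ U ∈ 𝓝 x, ∀ y ∈ U,
        (y ∈ Ω ↔ γ ((ℝ ∙ e)ᗮ.orthogonalProjectionOnto y) < inner ℝ e y)

/-- A partition of `Ω`: a collection of pairwise disjoint (open) Lipschitz domains, the elements,
whose closures cover exactly the closure of `Ω`. -/
structure IsPartition (Ω : Set (Pt n)) (T : Set (Set (Pt n))) : Prop where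
  isLipschitzDomain : ∀ K ∈ T, IsLipschitzDomain K
  pairwiseDisjoint : T.PairwiseDisjoint id
  closure_eq : closure Ω = ⋃ K ∈ T, closure K

/-- `C_c^∞(K)`: smooth functions on `ℝⁿ` with compact support contained in `K`. -/
structure IsTest (K : Set (Pt n)) (φ : Pt n → ℝ) : Prop where
  smooth : ContDiff ℝ ∞ φ
  compact : HasCompactSupport φ
  support : tsupport φ ⊆ K

/-- `L₂(Ω)`. -/
abbrev L2 (Ω : Set (Pt n)) : Type := Lp ℝ 2 (volume.restrict Ω)

/-- `L_∞(Ω)`. -/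
abbrev LInf (Ω : Set (Pt n)) : Type := Lp ℝ ∞ (volume.restrict Ω)

instance (Ω : Set (Pt n)) : NormedAddCommGroup (L2 Ω) := Lp.instNormedAddCommGroup

instance (Ω : Set (Pt n)) : NormedSpace ℝ (L2 Ω) := Lp.instNormedSpace

/-- `W⁰_∞(div; Ω)`: a vector field in `L_∞(Ω)ⁿ` together with its distributional divergence,
which is required to lie in `L_∞(Ω)`. -/
structure DivField (Ω : Set (Pt n)) where
  field : Lp (Pt n) ∞ (volume.restrict Ω)
  div : LInf Ω
  weak_div : ∀ φ, IsTest Ω φ →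
    ∫ x in Ω, fderiv ℝ φ x (field x) = -∫ x in Ω, div x * φ x

variable {Ω : Set (Pt n)}

/-! ### Graph spaces -/

/-- The function `div (φ b) = b · ∇φ + φ div b`. -/
def DivField.divMul (b : DivField Ω) (φ : Pt n → ℝ) (x : Pt n) : ℝ :=
  fderiv ℝ φ x (b.field x) + b.div x * φ x

theorem IsTest.memLp {K : Set (Pt n)} {φ : Pt n → ℝ} (h : IsTest K φ) :
    MemLp φ 2 (volume.restrict Ω) :=
  (h.smooth.continuous.memLp_of_hasCompactSupport h.compact).restrict Ω

theorem IsTest.memLp_divMul {K : Set (Pt n)} {φ : Pt n → ℝ} (h : IsTest K φ)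
    (b : DivField Ω) : MemLp (b.divMul φ) 2 (volume.restrict Ω) := by
  have h1 : MemLp (fderiv ℝ φ) 2 (volume.restrict Ω) :=
    ((h.smooth.continuous_fderiv (by simp)).memLp_of_hasCompactSupport
      (h.compact.fderiv ℝ)).restrict Ω
  have h2 := (ContinuousLinearMap.id ℝ (Pt n →L[ℝ] ℝ)).memLp_of_bilin 2 h1 (Lp.memLp b.field)
  have h3 := (ContinuousLinearMap.mul ℝ ℝ).memLp_of_bilin 2 (Lp.memLp b.div)
    (h.memLp (Ω := Ω))
  exact h2.add h3

/-- `g = b · ∇v` in the weak sense on the open set `K ⊆ Ω`, where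
`b · ∇v := div (v b) - v div b` as a distribution. -/
def IsWeakDirDeriv (b : DivField Ω) (K : Set (Pt n)) (v g : L2 Ω) : Prop :=
  ∀ φ, IsTest K φ → ∫ x in Ω, v x * b.divMul φ x = -∫ x in Ω, g x * φ x

/-- Given a collection `T` of open subsets of `Ω`, the space of all pairs `(v, b · ∇v)` with
`v ∈ L₂(Ω)` whose directional derivative, taken separately on each member of `T`, is in `L₂(Ω)`.
The norm is that of the product, `‖v‖² + ‖b · ∇v‖²`. -/
def graphSpace (b : DivField Ω) (T : Set (Set (Pt n))) :
    Submodule ℝ (WithLp 2 (L2 Ω × L2 Ω)) where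
  carrier := {p | ∀ K ∈ T, IsWeakDirDeriv b K p.fst p.snd}
  zero_mem' := by
    intro K _ φ _
    have key : ∀ ψ : Pt n → ℝ, ∫ x in Ω, (0 : L2 Ω) x * ψ x = 0 := by
      intro ψ
      rw [← integral_zero (Pt n) ℝ (μ := volume.restrict Ω)]
      refine integral_congr_ae ?_
      filter_upwards [Lp.coeFn_zero ℝ 2 (volume.restrict Ω)] with x hx
      rw [hx, Pi.zero_apply, zero_mul]
    rw [WithLp.zero_fst, WithLp.zero_snd, key, key, neg_zero]
  add_mem' := by
    intro p q hp hq K hK φ hφ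
    have key : ∀ (f g : L2 Ω) (ψ : Pt n → ℝ), MemLp ψ 2 (volume.restrict Ω) →
        ∫ x in Ω, (f + g : L2 Ω) x * ψ x = (∫ x in Ω, f x * ψ x) + ∫ x in Ω, g x * ψ x := by
      intro f g ψ hψ
      have hf : Integrable (fun x => f x * ψ x) (volume.restrict Ω) :=
        (Lp.memLp f).integrable_mul hψ
      have hg : Integrable (fun x => g x * ψ x) (volume.restrict Ω) :=
        (Lp.memLp g).integrable_mul hψ
      rw [← integral_add hf hg]
      refine integral_congr_ae ?_
      filter_upwards [Lp.coeFn_add f g] with x hx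
      rw [hx, Pi.add_apply, add_mul]
    have e1 := hp K hK φ hφ
    have e2 := hq K hK φ hφ
    rw [WithLp.add_fst, WithLp.add_snd, key _ _ _ (hφ.memLp_divMul b), key _ _ _ hφ.memLp,
      e1, e2]
    ring
  smul_mem' := by
    intro r p hp K hK φ hφ
    have key : ∀ (f : L2 Ω) (ψ : Pt n → ℝ),
        ∫ x in Ω, (r • f : L2 Ω) x * ψ x = r * ∫ x in Ω, f x * ψ x := by
      intro f ψ
      rw [← integral_const_mul]
      refine integral_congr_ae ?_
      filter_upwards [Lp.coeFn_smul r f] with x hx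
      rw [hx, Pi.smul_apply, smul_eq_mul, mul_assoc]
    rw [WithLp.smul_fst, WithLp.smul_snd, key, key, hp K hK φ hφ]
    ring

instance (b : DivField Ω) (T : Set (Set (Pt n))) : NormedAddCommGroup (graphSpace b T) :=
  Submodule.normedAddCommGroup _

instance (b : DivField Ω) (T : Set (Set (Pt n))) : NormedSpace ℝ (graphSpace b T) :=
  Submodule.normedSpace _

/-- `H(b; Ω) = {u ∈ L₂(Ω) : b · ∇u ∈ L₂(Ω)}`. -/
abbrev H (b : DivField Ω) : Submodule ℝ (WithLp 2 (L2 Ω × L2 Ω)) := graphSpace b {Ω}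

/-- The broken space `H(b; Ω_h) = {v ∈ L₂(Ω) : b · ∇_h v ∈ L₂(Ω)}` of the partition `T = Ω_h`. -/
abbrev HBroken (b : DivField Ω) (T : Set (Set (Pt n))) :
    Submodule ℝ (WithLp 2 (L2 Ω × L2 Ω)) := graphSpace b T

/-- `v`, as an element of `L₂(Ω)`. -/
def val (b : DivField Ω) (T : Set (Set (Pt n))) : graphSpace b T →L[ℝ] L2 Ω :=
  (WithLp.fstL 2 ℝ (L2 Ω) (L2 Ω)).comp (graphSpace b T).subtypeL

/-- The (piecewise) directional derivative `b · ∇v`, as an element of `L₂(Ω)`. -/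
def dirDeriv (b : DivField Ω) (T : Set (Set (Pt n))) : graphSpace b T →L[ℝ] L2 Ω :=
  (WithLp.sndL 2 ℝ (L2 Ω) (L2 Ω)).comp (graphSpace b T).subtypeL

/-! ### Inflow and outflow boundary -/

/-- `β` is the normal trace `b · n` on `∂Ω` (up to a positive constant, since the Hausdorff measure
is a constant multiple of the surface measure):
`∫_Ω b · ∇φ + φ div b = ∫_{∂Ω} φ b · n` for all smooth `φ`. -/
structure IsNormalTrace (b : DivField Ω) (β : Pt n → ℝ) : Prop where
  measurable : Measurable β
  integrable : IntegrableOn β (frontier Ω) (Measure.hausdorffMeasure ((n : ℝ) - 1))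
  green : ∀ φ, IsTest Set.univ φ → ∫ x in Ω, b.divMul φ x =
    ∫ x in frontier Ω, β x * φ x ∂(Measure.hausdorffMeasure ((n : ℝ) - 1))

open Classical in
/-- The normal trace `b · n` on `∂Ω`, which is unique up to boundary null sets. -/
def normalTrace (b : DivField Ω) : Pt n → ℝ :=
  if h : ∃ β, IsNormalTrace b β then h.choose else 0

/-- The inflow boundary `Γ₋ = {b · n < 0}` (up to a null set). -/
def inflow (b : DivField Ω) : Set (Pt n) := {x ∈ frontier Ω | normalTrace b x < 0}

/-- The outflow boundary `Γ₊ = {b · n > 0}` (up to a null set). -/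
def outflow (b : DivField Ω) : Set (Pt n) := {x ∈ frontier Ω | 0 < normalTrace b x}

/-- `{u ∈ H(b; Ω) ∩ C(Ω̄) : u = 0 on Γ}`, for `Γ ⊆ ∂Ω` given up to null sets. -/
def contVanishing (b : DivField Ω) (Γ : Set (Pt n)) : Submodule ℝ (H b) where
  carrier := {u | ∃ f : Pt n → ℝ, ContinuousOn f (closure Ω) ∧
    val b {Ω} u =ᵐ[volume.restrict Ω] f ∧
    ∀ᵐ x ∂(Measure.hausdorffMeasure ((n : ℝ) - 1)).restrict (frontier Ω), x ∈ Γ → f x = 0}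
  zero_mem' := ⟨0, continuousOn_const, by
    rw [map_zero]; exact Lp.coeFn_zero ℝ 2 (volume.restrict Ω), by simp⟩
  add_mem' := by
    rintro u v ⟨f, hf, huf, hf0⟩ ⟨g, hg, hvg, hg0⟩
    refine ⟨f + g, hf.add hg, ?_, ?_⟩
    · rw [map_add]
      filter_upwards [Lp.coeFn_add (val b {Ω} u) (val b {Ω} v), huf, hvg] with x h1 h2 h3
      rw [h1, Pi.add_apply, Pi.add_apply, h2, h3]
    · filter_upwards [hf0, hg0] with x h1 h2 hx
      simp [h1 hx, h2 hx]
  smul_mem' := by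
    rintro r u ⟨f, hf, huf, hf0⟩
    refine ⟨r • f, hf.const_smul r, ?_, ?_⟩
    · rw [map_smul]
      filter_upwards [Lp.coeFn_smul r (val b {Ω} u), huf] with x h1 h2
      simp [h1, h2]
    · filter_upwards [hf0] with x h1 hx
      simp [h1 hx]

/-- `H_{0,Γ₋}(b; Ω)`, a closure in `H(b; Ω)`. -/
abbrev HInflow (b : DivField Ω) : Submodule ℝ (H b) :=
  (contVanishing b (inflow b)).topologicalClosure

/-- `H_{0,Γ₊}(b; Ω)`, a closure in `H(b; Ω)`. -/
abbrev HOutflow (b : DivField Ω) : Submodule ℝ (H b) :=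
  (contVanishing b (outflow b)).topologicalClosure

instance (b : DivField Ω) : NormedAddCommGroup (HInflow b) := Submodule.normedAddCommGroup _

instance (b : DivField Ω) : NormedSpace ℝ (HInflow b) := Submodule.normedSpace _

instance (b : DivField Ω) : NormedAddCommGroup (HOutflow b) := Submodule.normedAddCommGroup _

instance (b : DivField Ω) : NormedSpace ℝ (HOutflow b) := Submodule.normedSpace _

/-! ### The transport operators -/

/-- Multiplication by a bounded function, on `L₂(Ω)`. -/
def mulOp (a : LInf Ω) : L2 Ω →L[ℝ] L2 Ω :=
  (ContinuousLinearMap.mul ℝ ℝ).holderL (volume.restrict Ω) ∞ 2 2 a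

/-- `v ↦ b · ∇v + c v`, piecewise with respect to `T`. -/
def transportOp (b : DivField Ω) (c : LInf Ω) (T : Set (Set (Pt n))) :
    graphSpace b T →L[ℝ] L2 Ω :=
  dirDeriv b T + (mulOp c).comp (val b T)

/-- `v ↦ c v - b · ∇v - v div b = c v - div (v b)`, piecewise with respect to `T`. -/
def transportAdjOp (b : DivField Ω) (c : LInf Ω) (T : Set (Set (Pt n))) :
    graphSpace b T →L[ℝ] L2 Ω :=
  (mulOp c).comp (val b T) - dirDeriv b T - (mulOp b.div).comp (val b T)

/-- `B : H_{0,Γ₋}(b; Ω) → L₂(Ω)`, `u ↦ b · ∇u + c u`. -/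
def opB (b : DivField Ω) (c : LInf Ω) : HInflow b →L[ℝ] L2 Ω :=
  (transportOp b c {Ω}).comp (HInflow b).subtypeL

/-- `B* : H_{0,Γ₊}(b; Ω) → L₂(Ω)`, `v ↦ c v - div (v b)`. -/
def opBStar (b : DivField Ω) (c : LInf Ω) : HOutflow b →L[ℝ] L2 Ω :=
  (transportAdjOp b c {Ω}).comp (HOutflow b).subtypeL

/-! ### Traces on the mesh skeleton -/

/-- Restriction `L₂(Ω) → L₂(K)` to a subset `K ⊆ Ω`. -/
abbrev restr (Ω K : Set (Pt n)) :
    L2 Ω →L[ℝ] Lp ℝ 2 ((volume.restrict Ω).restrict K) :=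
  LpToLpRestrictCLM (Pt n) ℝ ℝ (volume.restrict Ω) 2 K

/-- The bilinear form `(f, g) ↦ ∫_K f g` on `L₂(K)`. -/
abbrev pairL2 (Ω K : Set (Pt n)) :
    Lp ℝ 2 ((volume.restrict Ω).restrict K) →L[ℝ]
      Lp ℝ 2 ((volume.restrict Ω).restrict K) →L[ℝ] ℝ :=
  (ContinuousLinearMap.mul ℝ ℝ).lpPairing ((volume.restrict Ω).restrict K) 2 2

/-- The boundary form `∫_{∂K} v w b · n_K` of an element `K`, for `v` in the broken space and
`w ∈ H_{0,Γ₋}(b; Ω)`. As for any normal trace of an `L₂` field with `L₂` divergence it is defined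
by Green's formula, as `∫_K (b · ∇v) w + v (b · ∇w + w div b)`. -/
def elementForm (b : DivField Ω) (T : Set (Set (Pt n))) (K : Set (Pt n)) :
    HBroken b T →L[ℝ] HInflow b →L[ℝ] ℝ :=
  (pairL2 Ω K).bilinearComp ((restr Ω K).comp (dirDeriv b T))
      ((restr Ω K).comp ((val b {Ω}).comp (HInflow b).subtypeL)) +
    (pairL2 Ω K).bilinearComp ((restr Ω K).comp (val b T))
      ((restr Ω K).comp ((dirDeriv b {Ω} + (mulOp b.div).comp (val b {Ω})).comp
        (HInflow b).subtypeL))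

/-- The functions `w ∈ H_{0,Γ₋}(b; Ω)` with `w|_{∂Ω_h} = 0`: on the boundary of every element `K`
the trace of `w` vanishes, i.e. `∫_{∂K} v w b · n_K = 0` for all `v` in `H(b; K)`. The
characteristic part of `∂K` does not contribute to these integrals. -/
def zeroTrace (b : DivField Ω) (T : Set (Set (Pt n))) : Submodule ℝ (HInflow b) :=
  ⨅ K ∈ T, ⨅ v : HBroken b T, LinearMap.ker (elementForm b T K v).toLinearMap

theorem mem_zeroTrace {b : DivField Ω} {T : Set (Set (Pt n))} {w : HInflow b} :
    w ∈ zeroTrace b T ↔ ∀ K ∈ T, ∀ v : HBroken b T, elementForm b T K v w = 0 := by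
  simp [zeroTrace]

instance (b : DivField Ω) (T : Set (Set (Pt n))) :
    IsClosed (zeroTrace b T : Set (HInflow b)) := by
  have : (zeroTrace b T : Set (HInflow b)) =
      ⋂ K ∈ T, ⋂ v : HBroken b T, {w | elementForm b T K v w = 0} := by
    ext w
    simp [mem_zeroTrace]
  rw [this]
  exact isClosed_biInter fun K _ => isClosed_iInter fun v =>
    isClosed_eq (elementForm b T K v).continuous continuous_const

/-- `H_{0,Γ₋}(b; ∂Ω_h) = {w|_{∂Ω_h} : w ∈ H_{0,Γ₋}(b; Ω)}`, where two functions have the same trace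
if their difference has zero trace. It carries the quotient norm
`‖θ‖ = inf {‖w‖_{H(b; Ω)} : w|_{∂Ω_h} = θ}`. -/
abbrev HSkeleton (b : DivField Ω) (T : Set (Set (Pt n))) : Type :=
  HInflow b ⧸ zeroTrace b T

instance (b : DivField Ω) (T : Set (Set (Pt n))) : NormedAddCommGroup (HSkeleton b T) :=
  Submodule.Quotient.normedAddCommGroup _

instance (b : DivField Ω) (T : Set (Set (Pt n))) : NormedSpace ℝ (HSkeleton b T) :=
  Submodule.Quotient.normedSpace _ ℝ

/-- `∫_{∂K} v θ b · n_K` for `θ ∈ H_{0,Γ₋}(b; ∂Ω_h)` and `K ∈ Ω_h`. -/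
def skeletonElementForm (b : DivField Ω) (T : Set (Set (Pt n))) (K : T) (v : HBroken b T) :
    HSkeleton b T →ₗ[ℝ] ℝ :=
  (zeroTrace b T).liftQ (elementForm b T K v).toLinearMap
    fun _ hw => mem_zeroTrace.1 hw K K.2 v

/-- `∫_{∂Ω_h} ⟦v b⟧ θ`, the sum over the elements `K` of `∫_{∂K} v θ b · n_K`. -/
def skeletonForm (b : DivField Ω) (T : Set (Set (Pt n))) (v : HBroken b T)
    (θ : HSkeleton b T) : ℝ :=
  ∑' K : T, skeletonElementForm b T K v θ

/-! ### The broken variational formulation -/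

/-- The trial space `L₂(Ω) × H_{0,Γ₋}(b; ∂Ω_h)`, with squared norm `‖u‖² + ‖θ‖²`. -/
abbrev TrialSpace (b : DivField Ω) (T : Set (Set (Pt n))) : Type :=
  WithLp 2 (L2 Ω × HSkeleton b T)

/-- `b_h(u, θ; v) = ∫_Ω (c v - b · ∇_h v - v div b) u + ∫_{∂Ω_h} ⟦v b⟧ θ`. -/
def dpgForm (b : DivField Ω) (c : LInf Ω) (T : Set (Set (Pt n)))
    (p : TrialSpace b T) (v : HBroken b T) : ℝ :=
  (∫ x in Ω, transportAdjOp b c T v x * p.fst x) + skeletonForm b T v p.snd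

end Transport

end

open Transport

open MeasureTheory Topology
open scoped ENNReal ContDiff

noncomputable section

namespace Transport

variable {n : ℕ} {Ω : Set (Pt n)} {T : Set (Set (Pt n))}

/-! Write `θ` as the trace of some `w` in H_{0,Γ₋}(b; Ω). The elements cover `Ω` up to a null set,
so the element boundary integrals add up to one form over `Ω`, `boundaryForm`. Cancelling the terms
of `w` against the adjoint operator gives B_h(u, θ)(v) = ⟨(c - div b) v - b·∇_h v, u - w⟩ + ⟨v, B w⟩
(`dpgForm_eq_opB`).

Surjectivity: by Hahn–Banach and Riesz in L₂ × L₂ a functional is ⟨q₁, v⟩ + ⟨q₂, b·∇_h v⟩. It is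
matched by w = B⁻¹(q₁ + (c - div b) q₂) and u = w - q₂, which also yields explicit bounds for `u`
and `θ` (`exists_dpgOp_eq`).

Injectivity: if B_h(u, θ) = 0, then z = w - u is orthogonal in the weak sense to all broken test
functions. Hence `z` has a weak derivative, its boundary form vanishes against every broken `v`, and
so it lies in H_{0,Γ₋} (`mem_closure_contVanishing`). There B z = B w, so z = w, that is u = 0 and
`w` has zero trace (`dpgOp_injective`).

Constant: with N = ‖F‖, κ = ‖c - div b‖ and x = ‖B⁻¹‖(1 + κ), the explicit bounds are ‖u‖ ≤ (x + 1)N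
and ‖θ‖ ≤ xN. They imply the stated constant once both inverse norms are at least 1. This holds as
soon as b·∇φ ≠ 0 for one test function, by fast oscillation (`exists_test_norm_lt`). Otherwise the
boundary form vanishes on H(b; Ω), and testing with (B*)⁻¹u gives ‖u‖ ≤ ‖(B*)⁻¹‖N directly. This
dichotomy avoids having to show that the boundary form vanishes between H_{0,Γ₋} and H_{0,Γ₊}. -/

/-! ### Geometry of Lipschitz domains and partitions. -/

theorem volume_graph_eq_zero {e : Pt n} (he : ‖e‖ = 1) {γ : ↥(ℝ ∙ e)ᗮ → ℝ} (hγ : Continuous γ) :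
    volume {y : Pt n | γ ((ℝ ∙ e)ᗮ.orthogonalProjectionOnto y) = inner ℝ e y} = 0 := by
  -- The translates of the graph by `e / (k + 1)` are pairwise disjoint, with bounded shifts;
  -- infinitely many such copies force measure zero.
  refine Measure.addHaar_eq_zero_of_disjoint_translates volume
    (fun k : ℕ => (1 / ((k : ℝ) + 1)) • e) ?_ ?_ ?_
  · refine isBounded_iff_forall_norm_le.2 ⟨1, ?_⟩
    rintro _ ⟨k, rfl⟩
    have : (0 : ℝ) < (k : ℝ) + 1 := by positivity
    rw [norm_smul, he, mul_one, Real.norm_of_nonneg (by positivity), div_le_one this]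
    linarith [(Nat.cast_nonneg k : (0 : ℝ) ≤ k)]
  · intro j k hjk
    refine Set.disjoint_left.2 ?_
    rintro _ ⟨_, rfl, y, hy, rfl⟩ ⟨_, rfl, z, hz, hyz⟩
    simp only [Set.mem_ofPred_eq] at hy hz hyz
    have hP : ∀ t : ℝ, (ℝ ∙ e)ᗮ.orthogonalProjectionOnto (t • e) = 0 := fun t => by
      rw [Submodule.orthogonalProjectionOnto_eq_zero_iff, Submodule.orthogonal_orthogonal]
      exact Submodule.smul_mem _ _ (Submodule.mem_span_singleton_self e)
    have h1 := congrArg (fun x => (ℝ ∙ e)ᗮ.orthogonalProjectionOnto x) hyz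
    have h2 := congrArg (fun x => inner ℝ e x) hyz
    simp only [map_add, hP, zero_add] at h1
    simp only [inner_add_right, inner_smul_right, real_inner_self_eq_norm_sq, he, ← hy, ← hz,
      h1] at h2
    have h3 : ((k : ℝ) + 1) = j + 1 := by
      have : 1 / ((k : ℝ) + 1) = 1 / ((j : ℝ) + 1) := by linarith
      simpa using this
    exact hjk (by exact_mod_cast (by linarith : (j : ℝ) = k))
  · exact (isClosed_eq (hγ.comp (ContinuousLinearMap.continuous _))
      (continuous_const.inner continuous_id)).measurableSet

/-- Near a boundary point of a Lipschitz domain, the boundary lies on the graph. -/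
theorem IsLipschitzDomain.exists_graph (hΩ : IsLipschitzDomain Ω) {x : Pt n}
    (hx : x ∈ frontier Ω) : ∃ e : Pt n, ‖e‖ = 1 ∧
    ∃ γ : ↥(ℝ ∙ e)ᗮ → ℝ, Continuous γ ∧ ∃ U : Set (Pt n), IsOpen U ∧ x ∈ U ∧
      (∀ y ∈ U, (y ∈ Ω ↔ γ ((ℝ ∙ e)ᗮ.orthogonalProjectionOnto y) < inner ℝ e y)) ∧
      ∀ y ∈ U, y ∈ frontier Ω →
        γ ((ℝ ∙ e)ᗮ.orthogonalProjectionOnto y) = inner ℝ e y := by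
  obtain ⟨e, he, γ, ⟨L, hL⟩, U, hU, h⟩ := hΩ.boundary x hx
  obtain ⟨U', hU', ho, hxU⟩ := mem_nhds_iff.1 hU
  refine ⟨e, he, γ, hL.continuous, U', ho, hxU, fun y hy => h y (hU' hy), fun y hy hyf => ?_⟩
  rw [hΩ.isOpen.frontier_eq] at hyf
  refine le_antisymm ?_ (not_lt.1 fun h1 => hyf.2 ((h y (hU' hy)).2 h1))
  have hc : Continuous fun z : Pt n => γ ((ℝ ∙ e)ᗮ.orthogonalProjectionOnto z) :=
    hL.continuous.comp (ContinuousLinearMap.continuous _)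
  have hi : Continuous fun z : Pt n => (inner ℝ e z : ℝ) := continuous_const.inner continuous_id
  by_contra! hlt
  have ho' := (isOpen_lt hi hc).inter ho
  obtain ⟨z, ⟨hz1, hz2⟩, hz3⟩ := mem_closure_iff.1 hyf.1 _ ho' ⟨hlt, hy⟩
  exact lt_asymm hz1 ((h z (hU' hz2)).1 hz3)

theorem IsLipschitzDomain.volume_frontier (hΩ : IsLipschitzDomain Ω) :
    volume (frontier Ω) = 0 := by
  refine measure_null_of_locally_null _ fun x hx => ?_
  obtain ⟨e, he, γ, hγ, U, hU, hxU, -, h⟩ := hΩ.exists_graph hx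
  refine ⟨frontier Ω ∩ U, inter_mem_nhdsWithin _ (hU.mem_nhds hxU), ?_⟩
  exact measure_mono_null (fun y hy => h y hy.2 hy.1) (volume_graph_eq_zero he hγ)

/-- A Lipschitz domain lies on one side of its boundary, so it has no slits; this is what puts the
elements of a partition inside `Ω` itself and not only inside its closure. -/
theorem IsLipschitzDomain.interior_closure (hΩ : IsLipschitzDomain Ω) :
    interior (closure Ω) = Ω := by
  refine Set.Subset.antisymm (fun x hx => ?_) (interior_maximal subset_closure hΩ.isOpen)
  by_contra hxΩ
  have hxf : x ∈ frontier Ω := by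
    rw [hΩ.isOpen.frontier_eq]; exact ⟨interior_subset hx, hxΩ⟩
  obtain ⟨e, he, γ, hγ, U, hU, hxU, hin, h⟩ := hΩ.exists_graph hxf
  -- Moving from `x` a little in direction `-e` stays in the closure but falls strictly below the
  -- graph: such a point is not in `Ω`, hence on the frontier, hence on the graph, a contradiction.
  have hlim : Filter.Tendsto (fun t : ℝ => x - t • e) (𝓝[>] 0) (𝓝 x) := by
    have : Continuous fun t : ℝ => x - t • e := by fun_prop
    simpa using (this.tendsto 0).mono_left nhdsWithin_le_nhds
  have hev := (hlim.eventually (isOpen_interior.mem_nhds hx)).and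
    ((hlim.eventually (hU.mem_nhds hxU)).and self_mem_nhdsWithin)
  obtain ⟨t, ht1, ht2, ht⟩ := hev.exists
  have ht : 0 < t := ht
  have hP : (ℝ ∙ e)ᗮ.orthogonalProjectionOnto (t • e) = 0 := by
    rw [Submodule.orthogonalProjectionOnto_eq_zero_iff, Submodule.orthogonal_orthogonal]
    exact Submodule.smul_mem _ _ (Submodule.mem_span_singleton_self e)
  have h1 : (inner ℝ e (x - t • e) : ℝ) =
      γ ((ℝ ∙ e)ᗮ.orthogonalProjectionOnto (x - t • e)) - t := by
    rw [map_sub, hP, sub_zero, h x hxU hxf, inner_sub_right, inner_smul_right,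
      real_inner_self_eq_norm_sq, he]
    ring
  have h2 : x - t • e ∉ Ω := fun h3 => by have := (hin _ ht2).1 h3; linarith
  have h3 : x - t • e ∈ frontier Ω := by
    rw [hΩ.isOpen.frontier_eq]; exact ⟨interior_subset ht1, h2⟩
  have := h _ ht2 h3
  linarith

theorem IsPartition.subset (hΩ : IsLipschitzDomain Ω) (hT : IsPartition Ω T) {K : Set (Pt n)}
    (hK : K ∈ T) : K ⊆ Ω := by
  rw [← hΩ.interior_closure]
  refine interior_maximal ?_ (hT.isLipschitzDomain K hK).isOpen
  rw [hT.closure_eq]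
  exact subset_closure.trans (Set.subset_biUnion_of_mem (u := closure) hK)

theorem IsPartition.countable (hT : IsPartition Ω T) : T.Countable :=
  hT.pairwiseDisjoint.countable_of_isOpen (fun K hK => (hT.isLipschitzDomain K hK).isOpen)
    fun K hK => (hT.isLipschitzDomain K hK).isConnected.nonempty

theorem IsPartition.ae_mem (hΩ : IsLipschitzDomain Ω) (hT : IsPartition Ω T) :
    ∀ᵐ x ∂(volume.restrict Ω), x ∈ ⋃ K : T, (K : Set (Pt n)) := by
  have h0 : volume (⋃ K ∈ T, frontier K) = 0 :=
    (measure_biUnion_null_iff hT.countable).2 fun K hK =>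
      (hT.isLipschitzDomain K hK).volume_frontier
  have h1 : ∀ᵐ x ∂(volume.restrict Ω), x ∉ ⋃ K ∈ T, frontier K :=
    ae_restrict_of_ae (measure_eq_zero_iff_ae_notMem.1 h0)
  filter_upwards [h1, ae_restrict_mem hΩ.isOpen.measurableSet] with x hx hxΩ
  have : x ∈ ⋃ K ∈ T, closure K := hT.closure_eq ▸ subset_closure hxΩ
  simp only [Set.mem_iUnion, exists_prop] at this hx ⊢
  obtain ⟨K, hK, hxK⟩ := this
  refine ⟨⟨K, hK⟩, by_contra fun h => hx ⟨K, hK, ?_⟩⟩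
  rw [(hT.isLipschitzDomain K hK).isOpen.frontier_eq]
  exact ⟨hxK, h⟩

/-! ### Inner products, multiplication operators and graphs of test functions in L₂. -/

theorem inner_L2_eq_integral (f g : L2 Ω) : inner ℝ f g = ∫ x in Ω, f x * g x := by
  rw [L2.inner_def]
  exact integral_congr_ae (Filter.Eventually.of_forall fun x => by simp [mul_comm])

theorem coeFn_mulOp (a : LInf Ω) (f : L2 Ω) :
    mulOp a f =ᵐ[volume.restrict Ω] fun x => a x * f x :=
  (ContinuousLinearMap.mul ℝ ℝ).coeFn_holder a f

theorem norm_mulOp_apply_le (a : LInf Ω) (f : L2 Ω) : ‖mulOp a f‖ ≤ ‖a‖ * ‖f‖ := by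
  have h := (ContinuousLinearMap.mul ℝ ℝ).norm_holder_apply_apply_le (r := 2) a f
  have h1 : ‖ContinuousLinearMap.mul ℝ ℝ‖ ≤ 1 := ContinuousLinearMap.opNorm_mul_le ℝ ℝ
  calc ‖mulOp a f‖ ≤ ‖ContinuousLinearMap.mul ℝ ℝ‖ * ‖a‖ * ‖f‖ := h
    _ ≤ 1 * ‖a‖ * ‖f‖ := by gcongr
    _ = ‖a‖ * ‖f‖ := by rw [one_mul]

theorem mulOp_sub (a d : LInf Ω) (f : L2 Ω) : mulOp (a - d) f = mulOp a f - mulOp d f := by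
  simp [mulOp, map_sub]

theorem inner_mulOp (a : LInf Ω) (f g : L2 Ω) :
    inner ℝ (mulOp a f) g = inner ℝ f (mulOp a g) := by
  rw [inner_L2_eq_integral, inner_L2_eq_integral]
  refine integral_congr_ae ?_
  filter_upwards [coeFn_mulOp a f, coeFn_mulOp a g] with x h1 h2
  rw [h1, h2]; ring

variable {K : Set (Pt n)} {φ : Pt n → ℝ}

/-- A test function, as an element of `L₂(Ω)`. -/
def IsTest.toL2 (h : IsTest K φ) : L2 Ω := (h.memLp (Ω := Ω)).toLp φ

/-- `div (φ b)` for a test function `φ`, as an element of `L₂(Ω)`. -/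
def IsTest.divToL2 (h : IsTest K φ) (b : DivField Ω) : L2 Ω := (h.memLp_divMul b).toLp _

theorem IsTest.mono {K' : Set (Pt n)} (h : IsTest K φ) (hK : K ⊆ K') : IsTest K' φ :=
  ⟨h.smooth, h.compact, h.support.trans hK⟩

theorem isWeakDirDeriv_iff {b : DivField Ω} {v g : L2 Ω} : IsWeakDirDeriv b K v g ↔
    ∀ (φ : Pt n → ℝ) (h : IsTest K φ),
      inner ℝ v (h.divToL2 b) = -inner ℝ g (h.toL2 : L2 Ω) := by
  refine forall_congr' fun φ => forall_congr' fun h => ?_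
  rw [inner_L2_eq_integral, inner_L2_eq_integral]
  have h1 : ∫ x in Ω, v x * h.divToL2 b x = ∫ x in Ω, v x * b.divMul φ x := by
    refine integral_congr_ae ?_
    filter_upwards [(h.memLp_divMul b).coeFn_toLp] with x hx
    rw [IsTest.divToL2, hx]
  have h2 : ∫ x in Ω, g x * (h.toL2 : L2 Ω) x = ∫ x in Ω, g x * φ x := by
    refine integral_congr_ae ?_
    filter_upwards [(h.memLp (Ω := Ω)).coeFn_toLp] with x hx
    rw [IsTest.toL2, hx]
  rw [h1, h2]

theorem graphSpace_mono {b : DivField Ω} (hT : ∀ K ∈ T, K ⊆ Ω) : H b ≤ graphSpace b T :=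
  fun _ hp K hK φ h => hp Ω rfl φ (h.mono (hT K hK))

/-- The pair `(φ, b · ∇φ)` of a test function `φ`. -/
def IsTest.toGraph (h : IsTest K φ) (b : DivField Ω) : WithLp 2 (L2 Ω × L2 Ω) :=
  WithLp.toLp 2 (h.toL2, h.divToL2 b - mulOp b.div h.toL2)

theorem IsTest.coeFn_toGraph_snd (h : IsTest K φ) (b : DivField Ω) :
    (h.toGraph b).snd =ᵐ[volume.restrict Ω] fun x => fderiv ℝ φ x (b.field x) := by
  have e1 := (h.memLp_divMul b).coeFn_toLp
  have e2 := (h.memLp (Ω := Ω)).coeFn_toLp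
  filter_upwards [Lp.coeFn_sub (h.divToL2 b) (mulOp b.div h.toL2),
    coeFn_mulOp b.div (h.toL2 : L2 Ω), e1, e2] with x h1 h2 h3 h4
  change (h.divToL2 b - mulOp b.div h.toL2 : L2 Ω) x = _
  rw [h1, Pi.sub_apply, h2, IsTest.divToL2, h3, IsTest.toL2, h4, DivField.divMul]
  ring

theorem IsTest.mul {ψ : Pt n → ℝ} (h : IsTest K φ) (h' : IsTest K ψ) :
    IsTest K (fun x => φ x * ψ x) :=
  ⟨h.smooth.mul h'.smooth, h.compact.mul_right, (tsupport_mul_subset_left).trans h.support⟩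

theorem IsTest.toGraph_mem (h : IsTest Ω φ) (b : DivField Ω) : h.toGraph b ∈ H b := by
  rintro K rfl ψ hψ
  -- Testing the weak divergence of `b` with the product `φ ψ` and expanding by the product rule
  -- gives the weak derivative of `φ`.
  have h0 := b.weak_div _ (h.mul hψ)
  have e1 := h.coeFn_toGraph_snd b
  have e2 := (h.memLp (Ω := K)).coeFn_toLp
  have i1 : Integrable (fun x => φ x * b.divMul ψ x) (volume.restrict K) :=
    h.memLp.integrable_mul (hψ.memLp_divMul b)
  have i2 : Integrable (fun x => fderiv ℝ φ x (b.field x) * ψ x) (volume.restrict K) :=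
    (((Lp.memLp (h.toGraph b).snd).ae_eq e1)).integrable_mul hψ.memLp
  have j1 : ∫ x in K, (h.toGraph b).fst x * b.divMul ψ x = ∫ x in K, φ x * b.divMul ψ x :=
    integral_congr_ae (by
      filter_upwards [e2] with x hx
      change (h.toL2 : L2 K) x * _ = _
      rw [IsTest.toL2, hx])
  have j2 : ∫ x in K, (h.toGraph b).snd x * ψ x = ∫ x in K, fderiv ℝ φ x (b.field x) * ψ x :=
    integral_congr_ae (by filter_upwards [e1] with x hx; rw [hx])
  rw [j1, j2, ← sub_eq_zero, sub_neg_eq_add, ← integral_add i1 i2]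
  have i3 : Integrable (fun x => b.div x * (φ x * ψ x)) (volume.restrict K) := by
    have : MemLp (fun x => b.div x * φ x) 2 (volume.restrict K) :=
      (ContinuousLinearMap.mul ℝ ℝ).memLp_of_bilin 2 (Lp.memLp b.div) h.memLp
    have h2 := this.integrable_mul (hψ.memLp (Ω := K))
    exact h2.congr (Filter.Eventually.of_forall fun x => mul_assoc _ _ _)
  have key : ∀ x, fderiv ℝ (fun x => φ x * ψ x) x (b.field x) =
      (φ x * b.divMul ψ x + fderiv ℝ φ x (b.field x) * ψ x) - b.div x * (φ x * ψ x) := by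
    intro x
    have hφd : DifferentiableAt ℝ φ x := h.smooth.differentiable (by simp) x
    have hψd : DifferentiableAt ℝ ψ x := hψ.smooth.differentiable (by simp) x
    rw [fderiv_fun_mul hφd hψd]
    simp only [DivField.divMul, add_apply, smul_apply,
      smul_eq_mul]
    ring
  simp only [key] at h0
  have h1 : ∫ x in K, (φ x * b.divMul ψ x + fderiv ℝ φ x (b.field x) * ψ x) -
      b.div x * (φ x * ψ x) = (∫ x in K, φ x * b.divMul ψ x + fderiv ℝ φ x (b.field x) * ψ x) -
      ∫ x in K, b.div x * (φ x * ψ x) := integral_sub (i1.add i2) i3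
  linarith

/-- Orthogonality to the graphs of all test functions: `g` is weakly differentiable. -/
theorem mem_H_of_orthogonal {b : DivField Ω} {r g : L2 Ω}
    (h : ∀ (φ : Pt n → ℝ) (hφ : IsTest Ω φ),
      inner ℝ (hφ.toL2 : L2 Ω) r + inner ℝ (hφ.toGraph b).snd g = 0) :
    (WithLp.toLp 2 (g, r - mulOp b.div g) : WithLp 2 (L2 Ω × L2 Ω)) ∈ H b := by
  rintro K rfl
  refine isWeakDirDeriv_iff.2 fun φ hφ => ?_
  have h0 := h φ hφ
  change inner ℝ (hφ.toL2 : L2 K) r + inner ℝ (hφ.divToL2 b - mulOp b.div hφ.toL2) g = 0 at h0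
  change inner ℝ g (hφ.divToL2 b) = -inner ℝ (r - mulOp b.div g) hφ.toL2
  rw [inner_sub_left, inner_mulOp] at h0
  rw [inner_sub_left, real_inner_comm, real_inner_comm _ r, real_inner_comm _ (mulOp b.div g)]
  linarith

/-! ### The boundary form and its splitting over the partition. -/

/-- The form `(v, w) ↦ ∫ (b · ∇v) w + v (b · ∇w + w div b)` on graphs. -/
def boundaryForm (b : DivField Ω) (p q : WithLp 2 (L2 Ω × L2 Ω)) : ℝ :=
  inner ℝ p.snd q.fst + inner ℝ p.fst (q.snd + mulOp b.div q.fst)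

theorem boundaryForm_comm (b : DivField Ω) (p q : WithLp 2 (L2 Ω × L2 Ω)) :
    boundaryForm b p q = boundaryForm b q p := by
  rw [boundaryForm, boundaryForm, inner_add_right, inner_add_right, ← inner_mulOp,
    real_inner_comm q.fst, real_inner_comm q.snd, real_inner_comm q.fst (mulOp b.div p.fst)]
  ring

/-- Multiplication by the indicator function of `K`. -/
def restrictL2 (hK : MeasurableSet K) (f : L2 Ω) : L2 Ω := ((Lp.memLp f).indicator hK).toLp _

theorem coeFn_restrictL2 (hK : MeasurableSet K) (f : L2 Ω) :
    restrictL2 hK f =ᵐ[volume.restrict Ω] K.indicator f :=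
  ((Lp.memLp f).indicator hK).coeFn_toLp

theorem inner_restrictL2 (hK : MeasurableSet K) (f g : L2 Ω) :
    inner ℝ (restrictL2 hK f) g = ∫ x in K, f x * g x ∂(volume.restrict Ω) := by
  rw [inner_L2_eq_integral, ← integral_indicator hK]
  refine integral_congr_ae ?_
  filter_upwards [coeFn_restrictL2 hK f] with x hx
  rw [hx, Set.indicator_mul_left]

theorem pairL2_restr (f g : L2 Ω) : pairL2 Ω K (restr Ω K f) (restr Ω K g) =
    ∫ x in K, f x * g x ∂(volume.restrict Ω) := by
  rw [pairL2, ContinuousLinearMap.lpPairing_eq_integral]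
  refine integral_congr_ae ?_
  filter_upwards [LpToLpRestrictCLM_coeFn ℝ K f, LpToLpRestrictCLM_coeFn ℝ K g] with x h1 h2
  rw [h1, h2]; rfl

theorem elementForm_apply (b : DivField Ω) (v : HBroken b T) (w : HInflow b) :
    elementForm b T K v w =
      (∫ x in K, v.1.snd x * w.1.1.fst x ∂(volume.restrict Ω)) +
        ∫ x in K, v.1.fst x * (w.1.1.snd + mulOp b.div w.1.1.fst : L2 Ω) x
          ∂(volume.restrict Ω) := by
  rw [← pairL2_restr, ← pairL2_restr]; rfl

theorem IsPartition.hasSum_integral (hΩ : IsLipschitzDomain Ω) (hT : IsPartition Ω T)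
    (f g : L2 Ω) : HasSum (fun K : T => ∫ x in (K : Set (Pt n)), f x * g x ∂(volume.restrict Ω))
      (inner ℝ f g) := by
  have : Countable T := hT.countable.to_subtype
  have hi : Integrable (fun x => f x * g x) (volume.restrict Ω) :=
    (Lp.memLp f).integrable_mul (Lp.memLp g)
  have h := hasSum_integral_iUnion (μ := volume.restrict Ω)
    (s := fun K : T => (K : Set (Pt n)))
    (fun K => (hT.isLipschitzDomain K K.2).isOpen.measurableSet)
    (fun K K' hne => hT.pairwiseDisjoint K.2 K'.2 (fun h => hne (Subtype.ext h)))
    hi.integrableOn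
  rwa [Measure.restrict_eq_self_of_ae_mem (hT.ae_mem hΩ), ← inner_L2_eq_integral] at h

/-- Countable additivity of the integral, since the elements are disjoint and cover `Ω` up to a null
set. A partition may be infinite, so summability matters: without it `tsum` would take the default
value 0. -/
theorem IsPartition.hasSum_elementForm (hΩ : IsLipschitzDomain Ω) (hT : IsPartition Ω T)
    (b : DivField Ω) (v : HBroken b T) (w : HInflow b) :
    HasSum (fun K : T => elementForm b T K v w) (boundaryForm b v.1 w.1.1) := by
  simp only [elementForm_apply]
  exact (hT.hasSum_integral hΩ _ _).add (hT.hasSum_integral hΩ _ _)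

/-- The broken space is stable under multiplication by indicator functions of elements. -/
theorem IsPartition.restrict_mem (hT : IsPartition Ω T) {b : DivField Ω}
    (v : HBroken b T) (hK : K ∈ T) (hm : MeasurableSet K) :
    (WithLp.toLp 2 (restrictL2 hm v.1.fst, restrictL2 hm v.1.snd) : WithLp 2 (L2 Ω × L2 Ω)) ∈
      HBroken b T := by
  intro K' hK' φ h
  change ∫ x in Ω, restrictL2 hm v.1.fst x * b.divMul φ x =
    -∫ x in Ω, restrictL2 hm v.1.snd x * φ x
  have e1 := coeFn_restrictL2 hm v.1.fst
  have e2 := coeFn_restrictL2 hm v.1.snd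
  -- Test functions are supported in a single element `K'`, on which the indicator of `K` is
  -- constantly 1 or constantly 0; the cut-off is never differentiated.
  have hφ0 : ∀ x ∉ K', φ x = 0 := fun x hx =>
    image_eq_zero_of_notMem_tsupport fun hx' => hx (h.support hx')
  have hd0 : ∀ x ∉ K', b.divMul φ x = 0 := fun x hx => by
    have h1 : tsupport (fderiv ℝ φ) ⊆ tsupport φ := tsupport_fderiv_subset ℝ
    have : fderiv ℝ φ x = 0 := image_eq_zero_of_notMem_tsupport fun hx' => hx (h.support (h1 hx'))
    simp [DivField.divMul, this, hφ0 x hx]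
  by_cases hKK : K = K'
  · subst hKK
    have h1 : ∫ x in Ω, restrictL2 hm v.1.fst x * b.divMul φ x =
        ∫ x in Ω, v.1.fst x * b.divMul φ x := by
      refine integral_congr_ae ?_
      filter_upwards [e1] with x hx
      rw [hx]
      by_cases hxK : x ∈ K
      · rw [Set.indicator_of_mem hxK]
      · rw [hd0 x hxK, mul_zero, mul_zero]
    have h2 : ∫ x in Ω, restrictL2 hm v.1.snd x * φ x = ∫ x in Ω, v.1.snd x * φ x := by
      refine integral_congr_ae ?_
      filter_upwards [e2] with x hx
      rw [hx]
      by_cases hxK : x ∈ K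
      · rw [Set.indicator_of_mem hxK]
      · rw [hφ0 x hxK, mul_zero, mul_zero]
    rw [h1, h2]
    exact v.2 K hK φ h
  · have hd : Disjoint K K' := hT.pairwiseDisjoint hK hK' hKK
    rw [integral_eq_zero_of_ae, integral_eq_zero_of_ae, neg_zero]
    · filter_upwards [e2] with x hx
      rw [hx]
      by_cases hxK : x ∈ K
      · rw [hφ0 x (Set.disjoint_left.1 hd hxK), mul_zero, Pi.zero_apply]
      · rw [Set.indicator_of_notMem hxK, zero_mul, Pi.zero_apply]
    · filter_upwards [e1] with x hx
      rw [hx]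
      by_cases hxK : x ∈ K
      · rw [hd0 x (Set.disjoint_left.1 hd hxK), mul_zero, Pi.zero_apply]
      · rw [Set.indicator_of_notMem hxK, zero_mul, Pi.zero_apply]

/-- The global form is the sum of the element forms; conversely, testing with `v` cut off to one
element isolates that element's form. -/
theorem IsPartition.mem_zeroTrace_iff (hΩ : IsLipschitzDomain Ω) (hT : IsPartition Ω T)
    {b : DivField Ω} {w : HInflow b} :
    w ∈ zeroTrace b T ↔ ∀ v : HBroken b T, boundaryForm b v.1 w.1.1 = 0 := by
  refine mem_zeroTrace.trans ⟨fun h v => ?_, fun h K hK v => ?_⟩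
  · refine (hT.hasSum_elementForm hΩ b v w).unique ?_
    simp only [h _ (Subtype.prop _), hasSum_zero]
  · have hm := (hT.isLipschitzDomain K hK).isOpen.measurableSet
    have := h ⟨_, hT.restrict_mem v hK hm⟩
    rw [elementForm_apply, ← inner_restrictL2 hm, ← inner_restrictL2 hm]
    exact this

theorem IsPartition.skeletonForm_mk (hΩ : IsLipschitzDomain Ω) (hT : IsPartition Ω T)
    (b : DivField Ω) (v : HBroken b T) (w : HInflow b) :
    skeletonForm b T v ((zeroTrace b T).mkQ w) = boundaryForm b v.1 w.1.1 :=
  (hT.hasSum_elementForm hΩ b v w).tsum_eq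

/-! ### The radical of the boundary form, and the two expressions for the broken form. -/

variable {b : DivField Ω} {c : LInf Ω}

theorem IsTest.mem_contVanishing (hΩ : IsOpen Ω) (h : IsTest Ω φ) {Γ : Set (Pt n)}
    (hΓ : Γ ⊆ frontier Ω) : (⟨h.toGraph b, h.toGraph_mem b⟩ : H b) ∈ contVanishing b Γ := by
  refine ⟨φ, h.smooth.continuous.continuousOn, h.memLp.coeFn_toLp, ?_⟩
  refine Filter.Eventually.of_forall fun x hx => ?_
  refine image_eq_zero_of_notMem_tsupport fun hx' => ?_
  have := hΓ hx
  rw [hΩ.frontier_eq] at this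
  exact this.2 (h.support hx')

/-- The radical of the boundary form on `H(b; Ω)` consists of limits of test functions. -/
theorem mem_closure_contVanishing (hΩ : IsOpen Ω) {Γ : Set (Pt n)} (hΓ : Γ ⊆ frontier Ω)
    (z : H b) (hz : ∀ v : H b, boundaryForm b v.1 z.1 = 0) :
    z ∈ (contVanishing b Γ).topologicalClosure := by
  -- In a Hilbert space the closure is the double orthogonal complement. A `q` orthogonal to the
  -- graphs of test functions gives `(q.snd, q.fst - div b * q.snd)` in H(b; Ω), and the boundary
  -- form of this element with `z` is exactly ⟨q, z⟩.
  have h1 : z.1 ∈ ((contVanishing b Γ).map (H b).subtype)ᗮᗮ := by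
    refine (Submodule.mem_orthogonal _ _).2 fun q hq => ?_
    have h2 : (WithLp.toLp 2 (q.snd, q.fst - mulOp b.div q.snd) : WithLp 2 (L2 Ω × L2 Ω)) ∈
        H b := by
      refine mem_H_of_orthogonal fun φ h => ?_
      have := (Submodule.mem_orthogonal _ _).1 hq _
        (Submodule.mem_map_of_mem (h.mem_contVanishing (b := b) hΩ hΓ))
      rwa [WithLp.prod_inner_apply] at this
    have h3 := hz ⟨_, h2⟩
    rw [boundaryForm_comm] at h3
    change inner ℝ z.1.snd q.snd +
      inner ℝ z.1.fst (q.fst - mulOp b.div q.snd + mulOp b.div q.snd) = 0 at h3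
    rw [sub_add_cancel] at h3
    rw [WithLp.prod_inner_apply]
    change inner ℝ q.fst z.1.fst + inner ℝ q.snd z.1.snd = 0
    rw [real_inner_comm, real_inner_comm z.1.snd]
    linarith
  rw [Submodule.orthogonal_orthogonal_eq_closure] at h1
  have h4 : (z : WithLp 2 (L2 Ω × L2 Ω)) ∈ closure
      ((↑) '' (contVanishing b Γ : Set (H b)) : Set (WithLp 2 (L2 Ω × L2 Ω))) := h1
  have h5 : IsInducing (Subtype.val : H b → WithLp 2 (L2 Ω × L2 Ω)) := ⟨rfl⟩
  rw [← SetLike.mem_coe, Submodule.topologicalClosure_coe, h5.closure_eq_preimage_closure_image]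
  exact h4

theorem transportAdjOp_apply (v : HBroken b T) :
    transportAdjOp b c T v = mulOp (c - b.div) v.1.fst - v.1.snd := by
  change mulOp c v.1.fst - v.1.snd - mulOp b.div v.1.fst = _
  rw [mulOp_sub]; abel

theorem opB_apply (w : HInflow b) : opB b c w = w.1.1.snd + mulOp c w.1.1.fst := rfl

theorem opBStar_apply (v : HOutflow b) :
    opBStar b c v = mulOp (c - b.div) v.1.1.fst - v.1.1.snd :=
  transportAdjOp_apply v.1

theorem IsPartition.dpgForm_eq (hΩ : IsLipschitzDomain Ω) (hT : IsPartition Ω T)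
    (p : TrialSpace b T) (w : HInflow b) (hw : (zeroTrace b T).mkQ w = p.snd) (v : HBroken b T) :
    dpgForm b c T p v = inner ℝ (transportAdjOp b c T v) p.fst + boundaryForm b v.1 w.1.1 := by
  rw [dpgForm, ← hw, hT.skeletonForm_mk hΩ, inner_L2_eq_integral]

/-- Adding and subtracting `w` in the volume term makes the derivatives of `v` in the boundary form
cancel, leaving `v` paired with `B w`. -/
theorem IsPartition.dpgForm_eq_opB (hΩ : IsLipschitzDomain Ω) (hT : IsPartition Ω T)
    (p : TrialSpace b T) (w : HInflow b) (hw : (zeroTrace b T).mkQ w = p.snd) (v : HBroken b T) :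
    dpgForm b c T p v = inner ℝ (mulOp (c - b.div) v.1.fst - v.1.snd) (p.fst - w.1.1.fst) +
      inner ℝ v.1.fst (opB b c w) := by
  rw [hT.dpgForm_eq hΩ p w hw, boundaryForm, opB_apply, transportAdjOp_apply, inner_sub_right _ p.fst,
    inner_sub_left _ _ w.1.1.fst, mulOp_sub, inner_sub_left _ _ w.1.1.fst, inner_mulOp,
    inner_mulOp, inner_add_right, inner_add_right]
  ring

/-! ### Continuity of the broken form. -/

theorem norm_sq_graph (p : WithLp 2 (L2 Ω × L2 Ω)) : ‖p‖ ^ 2 = ‖p.fst‖ ^ 2 + ‖p.snd‖ ^ 2 :=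
  WithLp.prod_norm_sq_eq_of_L2 p

theorem norm_fst_le (p : WithLp 2 (L2 Ω × L2 Ω)) : ‖p.fst‖ ≤ ‖p‖ :=
  abs_le_of_sq_le_sq' (by nlinarith [norm_sq_graph p, sq_nonneg ‖p.snd‖]) (norm_nonneg _) |>.2

theorem norm_snd_le (p : WithLp 2 (L2 Ω × L2 Ω)) : ‖p.snd‖ ≤ ‖p‖ :=
  abs_le_of_sq_le_sq' (by nlinarith [norm_sq_graph p, sq_nonneg ‖p.fst‖]) (norm_nonneg _) |>.2

theorem norm_transportAdjOp_le (v : HBroken b T) :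
    ‖transportAdjOp b c T v‖ ≤ (1 + ‖c - b.div‖) * ‖v‖ := by
  rw [transportAdjOp_apply]
  have h1 := norm_mulOp_apply_le (c - b.div) v.1.fst
  have h2 := norm_fst_le v.1
  have h3 := norm_snd_le v.1
  have h4 := norm_sub_le (mulOp (c - b.div) v.1.fst) v.1.snd
  have h5 : ‖c - b.div‖ * ‖v.1.fst‖ ≤ ‖c - b.div‖ * ‖v.1‖ := by gcongr
  rw [Submodule.coe_norm]
  linarith

theorem abs_boundaryForm_le (p q : WithLp 2 (L2 Ω × L2 Ω)) :
    |boundaryForm b p q| ≤ (1 + ‖b.div‖) * ‖p‖ * ‖q‖ := by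
  have h1 := abs_real_inner_le_norm p.snd q.fst
  have h2 := abs_real_inner_le_norm p.fst q.snd
  have h3 := abs_real_inner_le_norm p.fst (mulOp b.div q.fst)
  have h4 : ‖p.fst‖ * ‖mulOp b.div q.fst‖ ≤ ‖p‖ * (‖b.div‖ * ‖q‖) :=
    mul_le_mul (norm_fst_le p) ((norm_mulOp_apply_le _ _).trans
      (mul_le_mul_of_nonneg_left (norm_fst_le q) (norm_nonneg _))) (norm_nonneg _) (norm_nonneg _)
  have h5 : ‖p.snd‖ * ‖q.fst‖ + ‖p.fst‖ * ‖q.snd‖ ≤ ‖p‖ * ‖q‖ := by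
    refine abs_le_of_sq_le_sq' ?_ (by positivity) |>.2
    rw [mul_pow, norm_sq_graph p, norm_sq_graph q]
    nlinarith [sq_nonneg (‖p.snd‖ * ‖q.snd‖ - ‖p.fst‖ * ‖q.fst‖)]
  rw [boundaryForm, inner_add_right]
  have h6 := abs_add_le (inner ℝ p.snd q.fst)
    (inner ℝ p.fst q.snd + inner ℝ p.fst (mulOp b.div q.fst) : ℝ)
  have h7 := abs_add_le (inner ℝ p.fst q.snd : ℝ) (inner ℝ p.fst (mulOp b.div q.fst))
  linarith

theorem IsPartition.abs_dpgForm_le (hΩ : IsLipschitzDomain Ω) (hT : IsPartition Ω T)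
    (p : TrialSpace b T) (v : HBroken b T) :
    ‖dpgForm b c T p v‖ ≤ (2 + ‖b.div‖ + ‖c - b.div‖) * ‖p‖ * ‖v‖ := by
  have hp : ‖p‖ ^ 2 = ‖p.fst‖ ^ 2 + ‖p.snd‖ ^ 2 := WithLp.prod_norm_sq_eq_of_L2 p
  have h1 : ‖p.fst‖ ≤ ‖p‖ := abs_le_of_sq_le_sq' (by nlinarith [sq_nonneg ‖p.snd‖])
    (norm_nonneg _) |>.2
  have h2 : ‖p.snd‖ ≤ ‖p‖ := abs_le_of_sq_le_sq' (by nlinarith [sq_nonneg ‖p.fst‖])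
    (norm_nonneg _) |>.2
  -- The quotient norm is an infimum, so a representative is taken within `ε` of it and `ε` is sent
  -- to 0.
  have h3 : ∀ ε > 0, ‖dpgForm b c T p v‖ ≤
      (1 + ‖c - b.div‖) * ‖v‖ * ‖p‖ + (1 + ‖b.div‖) * ‖v‖ * (‖p‖ + ε) := by
    intro ε hε
    obtain ⟨w, hw, hwε⟩ := Submodule.Quotient.norm_mk_lt (S := zeroTrace b T) p.snd hε
    rw [hT.dpgForm_eq hΩ p w hw]
    refine (norm_add_le _ _).trans (add_le_add ?_ ?_)
    · refine (norm_inner_le_norm _ _).trans ?_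
      exact mul_le_mul (norm_transportAdjOp_le v) h1 (norm_nonneg _) (by positivity)
    · refine (abs_boundaryForm_le v.1 w.1.1).trans ?_
      exact mul_le_mul_of_nonneg_left (hwε.le.trans (by linarith)) (by positivity)
  have h4 : Filter.Tendsto (fun ε : ℝ => (1 + ‖c - b.div‖) * ‖v‖ * ‖p‖ +
      (1 + ‖b.div‖) * ‖v‖ * (‖p‖ + ε)) (𝓝[>] 0)
      (𝓝 ((1 + ‖c - b.div‖) * ‖v‖ * ‖p‖ + (1 + ‖b.div‖) * ‖v‖ * (‖p‖ + 0))) := by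
    refine Filter.Tendsto.mono_left (Continuous.tendsto ?_ 0) nhdsWithin_le_nhds
    fun_prop
  have h5 := ge_of_tendsto h4 (by filter_upwards [self_mem_nhdsWithin] with ε hε using h3 ε hε)
  linarith

/-- The broken form as an operator into the dual of the test space. -/
def IsPartition.dpgOp (hΩ : IsLipschitzDomain Ω) (hT : IsPartition Ω T) (b : DivField Ω)
    (c : LInf Ω) : TrialSpace b T →L[ℝ] StrongDual ℝ (HBroken b T) :=
  LinearMap.mkContinuous₂ (LinearMap.mk₂ ℝ (dpgForm b c T)
    (fun p q v => by
      -- Linearity is checked through representatives: `skeletonForm` is a `tsum`, and its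
      -- additivity comes from the closed formula.
      obtain ⟨w, hw⟩ := (zeroTrace b T).mkQ_surjective p.snd
      obtain ⟨z, hz⟩ := (zeroTrace b T).mkQ_surjective q.snd
      rw [hT.dpgForm_eq hΩ p w hw, hT.dpgForm_eq hΩ q z hz,
        hT.dpgForm_eq hΩ (p + q) (w + z) (by rw [map_add, hw, hz, WithLp.add_snd])]
      simp only [boundaryForm, WithLp.add_fst, WithLp.add_snd, Submodule.coe_add, inner_add_right,
        map_add]
      ring)
    (fun r p v => by
      obtain ⟨w, hw⟩ := (zeroTrace b T).mkQ_surjective p.snd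
      rw [hT.dpgForm_eq hΩ p w hw,
        hT.dpgForm_eq hΩ (r • p) (r • w) (by rw [map_smul, hw, WithLp.smul_snd])]
      simp only [boundaryForm, WithLp.smul_fst, WithLp.smul_snd, Submodule.coe_smul,
        inner_add_right, inner_smul_right, map_smul, smul_eq_mul]
      ring)
    (fun p u v => by
      obtain ⟨w, hw⟩ := (zeroTrace b T).mkQ_surjective p.snd
      simp only [hT.dpgForm_eq hΩ p w hw, boundaryForm, WithLp.add_fst, WithLp.add_snd,
        Submodule.coe_add, inner_add_left, map_add]
      ring)
    (fun r p v => by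
      obtain ⟨w, hw⟩ := (zeroTrace b T).mkQ_surjective p.snd
      simp only [hT.dpgForm_eq hΩ p w hw, boundaryForm, WithLp.smul_fst, WithLp.smul_snd,
        Submodule.coe_smul, real_inner_smul_left, map_smul, smul_eq_mul]
      ring)) (2 + ‖b.div‖ + ‖c - b.div‖) (hT.abs_dpgForm_le hΩ)

theorem IsPartition.dpgOp_apply (hΩ : IsLipschitzDomain Ω) (hT : IsPartition Ω T)
    (p : TrialSpace b T) (v : HBroken b T) : hT.dpgOp hΩ b c p v = dpgForm b c T p v := rfl

theorem IsPartition.norm_dpgOp_le (hΩ : IsLipschitzDomain Ω) (hT : IsPartition Ω T) :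
    ‖hT.dpgOp hΩ b c‖ ≤ 2 + ‖b.div‖ + ‖c - b.div‖ :=
  LinearMap.mkContinuous₂_norm_le _ (by positivity) _

/-! ### Bijectivity of the broken operator. -/

theorem IsPartition.dpgOp_injective (hΩ : IsLipschitzDomain Ω) (hT : IsPartition Ω T)
    (hB : Function.Injective (opB b c)) : Function.Injective (hT.dpgOp hΩ b c) := by
  refine (injective_iff_map_eq_zero _).2 fun p hp => ?_
  obtain ⟨w, hw⟩ := (zeroTrace b T).mkQ_surjective p.snd
  set z : L2 Ω := w.1.1.fst - p.fst with hz
  -- `r` is chosen so that B_h(u, θ) = 0 reads ⟨v, r⟩ + ⟨b·∇_h v, z⟩ = 0; then b·∇z = r - z div b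
  -- and B z = r + (c - div b) z = B w.
  set r : L2 Ω := opB b c w - mulOp (c - b.div) z with hr
  have h1 : ∀ v : HBroken b T, inner ℝ v.1.fst r + inner ℝ v.1.snd z = 0 := by
    intro v
    have h2 := DFunLike.congr_fun hp v
    rw [hT.dpgOp_apply hΩ, hT.dpgForm_eq_opB hΩ p w hw, ← neg_sub w.1.1.fst, ← hz, inner_neg_right,
      inner_sub_left, inner_mulOp] at h2
    have h2' : -(inner ℝ v.1.fst (mulOp (c - b.div) z) - inner ℝ v.1.snd z) +
      inner ℝ v.1.fst (opB b c w) = 0 := h2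
    rw [hr, inner_sub_right]
    linarith
  have hsub : H b ≤ HBroken b T := graphSpace_mono fun K hK => hT.subset hΩ hK
  have h3 : (WithLp.toLp 2 (z, r - mulOp b.div z) : WithLp 2 (L2 Ω × L2 Ω)) ∈ H b :=
    mem_H_of_orthogonal fun φ h => h1 ⟨_, hsub (h.toGraph_mem b)⟩
  have h4 : ∀ v : HBroken b T, boundaryForm b v.1 (WithLp.toLp 2 (z, r - mulOp b.div z)) = 0 := by
    intro v
    change inner ℝ v.1.snd z + inner ℝ v.1.fst (r - mulOp b.div z + mulOp b.div z) = 0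
    rw [sub_add_cancel, add_comm]
    exact h1 v
  have h5 : (⟨_, h3⟩ : H b) ∈ HInflow b :=
    mem_closure_contVanishing hΩ.isOpen (fun x hx => hx.1) _ fun v => h4 ⟨v.1, hsub v.2⟩
  have h6 : (⟨⟨_, h3⟩, h5⟩ : HInflow b) = w := by
    refine hB ?_
    rw [opB_apply]
    change r - mulOp b.div z + mulOp c z = _
    rw [hr, mulOp_sub]; abel
  have h7 : w ∈ zeroTrace b T := by
    refine (hT.mem_zeroTrace_iff hΩ).2 fun v => ?_
    rw [← h6]; exact h4 v
  have h8 : w.1.1.fst = z := by rw [← h6]; rfl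
  have h9 : p.fst = 0 := by
    exact sub_eq_self.1 (hz.symm.trans h8.symm)
  have h10 : p.snd = 0 := by
    rw [← hw]; exact (Submodule.Quotient.mk_eq_zero _).2 h7
  exact (WithLp.ofLp_injective 2) (Prod.ext h9 h10)

theorem IsPartition.exists_dpgOp_eq (hΩ : IsLipschitzDomain Ω) (hT : IsPartition Ω T)
    (e : HInflow b ≃L[ℝ] L2 Ω) (he : (e : HInflow b →L[ℝ] L2 Ω) = opB b c)
    (F : StrongDual ℝ (HBroken b T)) : ∃ p : TrialSpace b T, hT.dpgOp hΩ b c p = F ∧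
      ‖p.fst‖ ≤ (‖(e.symm : L2 Ω →L[ℝ] HInflow b)‖ * (1 + ‖c - b.div‖) + 1) * ‖F‖ ∧
      ‖p.snd‖ ≤ ‖(e.symm : L2 Ω →L[ℝ] HInflow b)‖ * (1 + ‖c - b.div‖) * ‖F‖ := by
  -- Norm-preserving extension to L₂ × L₂ makes the Riesz representative a pair of free L₂ functions
  -- with the norm of `F`.
  obtain ⟨G, hG, hGn⟩ := exists_extension_norm_eq (HBroken b T) F
  set q := (InnerProductSpace.toDual ℝ (WithLp 2 (L2 Ω × L2 Ω))).symm G with hq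
  have hqn : ‖q‖ = ‖F‖ := by rw [hq, LinearIsometryEquiv.norm_map, hGn]
  set f := q.fst + mulOp (c - b.div) q.snd with hf
  set w := e.symm f with hw
  have hBw : opB b c w = f := by
    rw [← he, hw]; simp
  have hfn : ‖f‖ ≤ (1 + ‖c - b.div‖) * ‖F‖ := by
    have h1 := norm_add_le q.fst (mulOp (c - b.div) q.snd)
    have h2 := norm_mulOp_apply_le (c - b.div) q.snd
    have h3 := norm_fst_le q
    have h4 : ‖c - b.div‖ * ‖q.snd‖ ≤ ‖c - b.div‖ * ‖q‖ := by gcongr; exact norm_snd_le q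
    rw [hqn] at h3 h4
    linarith
  have hwn : ‖w‖ ≤ ‖(e.symm : L2 Ω →L[ℝ] HInflow b)‖ * (1 + ‖c - b.div‖) * ‖F‖ := by
    rw [mul_assoc]
    exact ((e.symm : L2 Ω →L[ℝ] HInflow b).le_opNorm f).trans
      (mul_le_mul_of_nonneg_left hfn (norm_nonneg _))
  -- With u - w = -q₂ the volume term produces ⟨b·∇_h v, q₂⟩ and the surplus -⟨v, (c - div b) q₂⟩,
  -- which the choice of `f` compensates.
  refine ⟨WithLp.toLp 2 (w.1.1.fst - q.snd, (zeroTrace b T).mkQ w), ?_, ?_, ?_⟩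
  · refine ContinuousLinearMap.ext fun v => ?_
    rw [hT.dpgOp_apply hΩ, hT.dpgForm_eq_opB hΩ _ w rfl, hBw, ← hG]
    have h1 : G v.1 = inner ℝ q v.1 := by
      rw [hq, InnerProductSpace.toDual_symm_apply]
    rw [h1, WithLp.prod_inner_apply]
    change inner ℝ (mulOp (c - b.div) v.1.fst - v.1.snd) (w.1.1.fst - q.snd - w.1.1.fst) +
      inner ℝ v.1.fst f = inner ℝ q.fst v.1.fst + inner ℝ q.snd v.1.snd
    rw [sub_sub_cancel_left, inner_neg_right, inner_sub_left, inner_mulOp, hf, inner_add_right,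
      real_inner_comm q.fst, real_inner_comm q.snd]
    ring
  · refine (norm_sub_le _ _).trans ?_
    have h1 := norm_fst_le w.1.1
    have h2 := norm_snd_le q
    have h3 : ‖w.1.1‖ = ‖w‖ := rfl
    linarith
  · exact (Submodule.Quotient.norm_mk_le _ w).trans hwn

/-! ### The dichotomy behind the constant: vanishing boundary form or oscillating test functions. -/

theorem eq_zero_of_inner_test_eq_zero (hΩ : IsOpen Ω) {f : L2 Ω}
    (h : ∀ (φ : Pt n → ℝ) (hφ : IsTest Ω φ), inner ℝ f (hφ.toL2 : L2 Ω) = 0) : f = 0 := by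
  have h1 : LocallyIntegrableOn f Ω := by
    intro x _
    obtain ⟨s, hs, hi⟩ := ((Lp.memLp f).locallyIntegrable (by norm_num)) x
    refine ⟨s ∩ Ω, Filter.inter_mem (mem_nhdsWithin_of_mem_nhds hs) self_mem_nhdsWithin, ?_⟩
    rwa [IntegrableOn, Measure.restrict_restrict' hΩ.measurableSet] at hi
  have h2 := hΩ.ae_eq_zero_of_integral_contDiff_smul_eq_zero h1 fun φ h1 h2 h3 => by
    have h4 := h φ ⟨h1, h2, h3⟩
    rw [inner_L2_eq_integral] at h4
    have h5 : ∫ x in Ω, f x * (IsTest.toL2 ⟨h1, h2, h3⟩ : L2 Ω) x = ∫ x in Ω, φ x • f x := by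
      refine integral_congr_ae ?_
      filter_upwards [(IsTest.memLp (Ω := Ω) ⟨h1, h2, h3⟩).coeFn_toLp] with x hx
      rw [IsTest.toL2, hx, smul_eq_mul, mul_comm]
    rw [← setIntegral_eq_integral_of_forall_compl_eq_zero (s := Ω), ← h5, h4]
    intro x hx
    rw [image_eq_zero_of_notMem_tsupport fun hx' => hx (h3 hx'), zero_smul]
  refine Lp.ext ?_
  filter_upwards [(ae_restrict_iff' hΩ.measurableSet).2 h2,
    Lp.coeFn_zero ℝ 2 (volume.restrict Ω)] with x hx hx0
  rw [hx, hx0, Pi.zero_apply]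

/-- If `b · ∇φ = 0` for all test functions, then the boundary form vanishes. -/
theorem boundaryForm_eq_zero (hΩ : IsOpen Ω)
    (h : ∀ (φ : Pt n → ℝ) (hφ : IsTest Ω φ), (hφ.toGraph b).snd = 0) (p q : H b) :
    boundaryForm b p.1 q.1 = 0 := by
  -- Here div(φ b) = φ div b, so the weak derivative of any `p` is -p div b. Applied to test
  -- functions, whose derivative is 0, this forces div b = 0, and then every derivative vanishes.
  have h1 : ∀ (p : H b), p.1.snd + mulOp b.div p.1.fst = 0 := fun p => by
    refine eq_zero_of_inner_test_eq_zero hΩ fun φ hφ => ?_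
    have h2 := isWeakDirDeriv_iff.1 (p.2 Ω rfl) φ hφ
    have h3 : hφ.divToL2 b = mulOp b.div hφ.toL2 := sub_eq_zero.1 (h φ hφ)
    rw [h3, ← inner_mulOp] at h2
    rw [inner_add_left]
    linarith
  have h4 : ∀ f : L2 Ω, mulOp b.div f = 0 := fun f => by
    refine eq_zero_of_inner_test_eq_zero hΩ fun φ hφ => ?_
    have h5 := h1 ⟨_, hφ.toGraph_mem b⟩
    change (hφ.toGraph b).snd + mulOp b.div hφ.toL2 = 0 at h5
    rw [h φ hφ, zero_add] at h5
    rw [inner_mulOp, h5, inner_zero_right]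
  have h6 := h1 p
  rw [h4, add_zero] at h6
  rw [boundaryForm, h1 q, h6, inner_zero_left, inner_zero_right, add_zero]

theorem IsTest.sin_mul (h : IsTest Ω φ) (t : ℝ) : IsTest Ω fun x => Real.sin (t * φ x) where
  smooth := Real.contDiff_sin.comp (contDiff_const.mul h.smooth)
  compact := h.compact.comp_left (g := fun s => Real.sin (t * s)) (by simp)
  support := (tsupport_comp_subset (g := fun s => Real.sin (t * s)) (by simp) φ).trans h.support

/-- The shift by 1 makes the function vanish where `φ` does, which keeps the support compact. -/
theorem IsTest.one_sub_cos_mul (h : IsTest Ω φ) (t : ℝ) :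
    IsTest Ω fun x => 1 - Real.cos (t * φ x) where
  smooth := contDiff_const.sub (Real.contDiff_cos.comp (contDiff_const.mul h.smooth))
  compact := h.compact.comp_left (g := fun s => 1 - Real.cos (t * s)) (by simp)
  support := (tsupport_comp_subset (g := fun s => 1 - Real.cos (t * s)) (by simp) φ).trans
    h.support

/-- If `b · ∇φ ≠ 0` for some test function, then there are test functions that oscillate
arbitrarily fast along `b`. -/
theorem exists_test_norm_lt (hΩ : Bornology.IsBounded Ω) (h : IsTest Ω φ)
    (h0 : (h.toGraph b).snd ≠ 0) {M : ℝ} (hM : 0 ≤ M) :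
    ∃ (ψ : Pt n → ℝ) (hψ : IsTest Ω ψ),
      M * ‖(hψ.toGraph b).fst‖ ≤ ‖(hψ.toGraph b).snd‖ ∧ 0 < ‖(hψ.toGraph b).snd‖ := by
  have : IsFiniteMeasure (volume.restrict Ω) :=
    ⟨by rw [Measure.restrict_apply_univ]; exact hΩ.measure_lt_top⟩
  obtain ⟨R, hR0, hR⟩ : ∃ R : ℝ, 0 ≤ R ∧ ∀ (ψ : Pt n → ℝ) (hψ : IsTest Ω ψ),
      (∀ x, |ψ x| ≤ 2) → ‖(hψ.toGraph b).fst‖ ≤ R := by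
    refine ⟨measureUnivNNReal (volume.restrict Ω) ^ (2 : ℝ≥0∞).toReal⁻¹ * (2 : ℝ),
      by positivity, fun ψ hψ hb => ?_⟩
    · refine Lp.norm_le_of_ae_bound (C := 2) (by norm_num) ?_
      filter_upwards [(hψ.memLp (Ω := Ω)).coeFn_toLp] with x hx
      change ‖(hψ.toL2 : L2 Ω) x‖ ≤ 2
      rw [IsTest.toL2, hx]
      exact hb x
  have hD : 0 < ‖(h.toGraph b).snd‖ := norm_pos_iff.2 h0
  set d := ‖(h.toGraph b).snd‖ with hd
  -- Both oscillating functions have L₂ norm at most `R` whatever `t` is, while the squares of their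
  -- derivatives along `b` sum to (t d)². With t d = 2MR + 1 both derivative norms cannot be at most
  -- MR.
  set t : ℝ := (2 * (M * R) + 1) / d with ht
  have htd : t * d = 2 * (M * R) + 1 := div_mul_cancel₀ _ hD.ne'
  have hMR : 0 ≤ M * R := mul_nonneg hM hR0
  set p := (h.sin_mul t).toGraph b with hp
  set q := (h.one_sub_cos_mul t).toGraph b with hq
  have e1 : p.snd =ᵐ[volume.restrict Ω] fun x => t * Real.cos (t * φ x) * (h.toGraph b).snd x := by
    filter_upwards [(h.sin_mul t).coeFn_toGraph_snd b, h.coeFn_toGraph_snd b] with x h1 h2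
    have hφ : HasFDerivAt φ (fderiv ℝ φ x) x :=
      (h.smooth.differentiable (by simp) x).hasFDerivAt
    rw [h1, h2, (hφ.const_mul t).sin.fderiv]
    simp only [smul_apply, smul_eq_mul]
    ring
  have e2 : q.snd =ᵐ[volume.restrict Ω] fun x => t * Real.sin (t * φ x) * (h.toGraph b).snd x := by
    filter_upwards [(h.one_sub_cos_mul t).coeFn_toGraph_snd b, h.coeFn_toGraph_snd b]
      with x h1 h2
    have hφ : HasFDerivAt φ (fderiv ℝ φ x) x :=
      (h.smooth.differentiable (by simp) x).hasFDerivAt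
    rw [h1, h2, ((hφ.const_mul t).cos.const_sub 1).fderiv]
    simp only [smul_apply, neg_apply, smul_eq_mul]
    ring
  have hsum : ‖p.snd‖ ^ 2 + ‖q.snd‖ ^ 2 = (t * d) ^ 2 := by
    have hadd : ∫ x in Ω, (p.snd x * p.snd x + q.snd x * q.snd x) =
        (∫ x in Ω, p.snd x * p.snd x) + ∫ x in Ω, q.snd x * q.snd x :=
      integral_add ((Lp.memLp p.snd).integrable_mul (Lp.memLp p.snd))
        ((Lp.memLp q.snd).integrable_mul (Lp.memLp q.snd))
    rw [mul_pow, hd, ← real_inner_self_eq_norm_sq, ← real_inner_self_eq_norm_sq,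
      ← real_inner_self_eq_norm_sq, inner_L2_eq_integral, inner_L2_eq_integral,
      inner_L2_eq_integral, ← integral_const_mul, ← hadd]
    refine integral_congr_ae ?_
    filter_upwards [e1, e2] with x h1 h2
    rw [h1, h2]
    linear_combination (t ^ 2 * (h.toGraph b).snd x ^ 2) * Real.sin_sq_add_cos_sq (t * φ x)
  have hbp : M * ‖p.fst‖ ≤ M * R := by
    gcongr
    exact hR _ _ fun x => (Real.abs_sin_le_one _).trans one_le_two
  have hbq : M * ‖q.fst‖ ≤ M * R := by
    gcongr
    refine hR _ _ fun x => abs_le.2 ⟨?_, ?_⟩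
    · linarith [Real.cos_le_one (t * φ x)]
    · linarith [Real.neg_one_le_cos (t * φ x)]
  by_cases hlt : M * R < ‖p.snd‖
  · exact ⟨_, h.sin_mul t, hbp.trans hlt.le, hMR.trans_lt hlt⟩
  · have hlt' : M * R < ‖q.snd‖ := by
      by_contra hle
      rw [not_lt] at hlt hle
      have h1 := pow_le_pow_left₀ (norm_nonneg _) hlt 2
      have h2 := pow_le_pow_left₀ (norm_nonneg _) hle 2
      rw [htd] at hsum
      nlinarith
    exact ⟨_, h.one_sub_cos_mul t, hbq.trans hlt'.le, hMR.trans_lt hlt'⟩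

/-- On fast oscillating functions the derivative dominates both sides; dividing by its norm leaves 1
≤ A(1 + k/M), and M → ∞. -/
theorem one_le_of_oscillating (hΩ : Bornology.IsBounded Ω) (h : IsTest Ω φ)
    (h0 : (h.toGraph b).snd ≠ 0) {A k : ℝ} (hA : 0 ≤ A) (hk : 0 ≤ k)
    (hle : ∀ (ψ : Pt n → ℝ) (hψ : IsTest Ω ψ),
      ‖hψ.toGraph b‖ ≤ A * (‖(hψ.toGraph b).snd‖ + k * ‖(hψ.toGraph b).fst‖)) : 1 ≤ A := by
  have h1 : ∀ M : ℝ, 0 < M → 1 ≤ A * (1 + k * M⁻¹) := fun M hM => by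
    obtain ⟨ψ, hψ, h2, h3⟩ := exists_test_norm_lt hΩ h h0 hM.le
    have h4 := (norm_snd_le _).trans (hle ψ hψ)
    have h5 : ‖(hψ.toGraph b).fst‖ ≤ M⁻¹ * ‖(hψ.toGraph b).snd‖ := by
      rwa [le_inv_mul_iff₀ hM]
    have h6 : A * (‖(hψ.toGraph b).snd‖ + k * ‖(hψ.toGraph b).fst‖) ≤
        A * (‖(hψ.toGraph b).snd‖ + k * (M⁻¹ * ‖(hψ.toGraph b).snd‖)) := by gcongr
    refine le_of_mul_le_mul_right ?_ h3
    linarith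
  have h2 : Filter.Tendsto (fun M : ℝ => A * (1 + k * M⁻¹)) Filter.atTop
      (𝓝 (A * (1 + k * 0))) :=
    ((tendsto_inv_atTop_zero.const_mul k).const_add 1).const_mul A
  have h3 := ge_of_tendsto h2 (by filter_upwards [Filter.eventually_gt_atTop 0] with M hM
                                  using h1 M hM)
  simpa using h3

theorem one_le_norm_opB_symm (hΩ : IsLipschitzDomain Ω) (h : IsTest Ω φ)
    (h0 : (h.toGraph b).snd ≠ 0) (e : HInflow b ≃L[ℝ] L2 Ω)
    (he : (e : HInflow b →L[ℝ] L2 Ω) = opB b c) :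
    1 ≤ ‖(e.symm : L2 Ω →L[ℝ] HInflow b)‖ := by
  refine one_le_of_oscillating hΩ.isBounded h h0 (norm_nonneg _) (norm_nonneg c) fun ψ hψ => ?_
  set w : HInflow b := ⟨⟨_, hψ.toGraph_mem b⟩, Submodule.le_topologicalClosure _
    (hψ.mem_contVanishing hΩ.isOpen fun x hx => hx.1)⟩ with hw
  have h1 := (e.symm : L2 Ω →L[ℝ] HInflow b).le_opNorm (opB b c w)
  have h2 : (e.symm : L2 Ω →L[ℝ] HInflow b) (opB b c w) = w := by rw [← he]; simp
  rw [h2] at h1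
  refine h1.trans (mul_le_mul_of_nonneg_left ?_ (norm_nonneg _))
  rw [opB_apply]
  exact (norm_add_le _ _).trans (add_le_add le_rfl (norm_mulOp_apply_le _ _))

theorem one_le_norm_opBStar_symm (hΩ : IsLipschitzDomain Ω) (h : IsTest Ω φ)
    (h0 : (h.toGraph b).snd ≠ 0) (e : HOutflow b ≃L[ℝ] L2 Ω)
    (he : (e : HOutflow b →L[ℝ] L2 Ω) = opBStar b c) :
    1 ≤ ‖(e.symm : L2 Ω →L[ℝ] HOutflow b)‖ := by
  refine one_le_of_oscillating hΩ.isBounded h h0 (norm_nonneg _) (norm_nonneg (c - b.div))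
    fun ψ hψ => ?_
  set w : HOutflow b := ⟨⟨_, hψ.toGraph_mem b⟩, Submodule.le_topologicalClosure _
    (hψ.mem_contVanishing hΩ.isOpen fun x hx => hx.1)⟩ with hw
  have h1 := (e.symm : L2 Ω →L[ℝ] HOutflow b).le_opNorm (opBStar b c w)
  have h2 : (e.symm : L2 Ω →L[ℝ] HOutflow b) (opBStar b c w) = w := by rw [← he]; simp
  rw [h2] at h1
  refine h1.trans (mul_le_mul_of_nonneg_left ?_ (norm_nonneg _))
  rw [opBStar_apply, add_comm]
  exact (norm_sub_le _ _).trans (add_le_add (norm_mulOp_apply_le _ _) le_rfl)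

/-- If the boundary form vanishes, the first component is controlled by the adjoint operator. -/
theorem IsPartition.norm_fst_le_of_boundaryForm_eq_zero (hΩ : IsLipschitzDomain Ω)
    (hT : IsPartition Ω T) (h0 : ∀ p q : H b, boundaryForm b p.1 q.1 = 0)
    (e : HOutflow b ≃L[ℝ] L2 Ω) (he : (e : HOutflow b →L[ℝ] L2 Ω) = opBStar b c)
    (p : TrialSpace b T) :
    ‖p.fst‖ ≤ ‖(e.symm : L2 Ω →L[ℝ] HOutflow b)‖ * ‖hT.dpgOp hΩ b c p‖ := by
  obtain ⟨w, hw⟩ := (zeroTrace b T).mkQ_surjective p.snd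
  set v := e.symm p.fst with hv
  have hBv : opBStar b c v = p.fst := by rw [← he, hv]; simp
  have hsub : H b ≤ HBroken b T := graphSpace_mono fun K hK => hT.subset hΩ hK
  -- For an unbroken test function the boundary term vanishes by `h0`, so only ⟨B* v, u⟩ with B* v =
  -- u remains.
  have h1 : hT.dpgOp hΩ b c p ⟨v.1.1, hsub v.1.2⟩ = ‖p.fst‖ ^ 2 := by
    rw [hT.dpgOp_apply hΩ, hT.dpgForm_eq hΩ p w hw, h0 v.1 w.1, add_zero]
    change inner ℝ (opBStar b c v) p.fst = _
    rw [hBv, real_inner_self_eq_norm_sq]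
  have h2 := (hT.dpgOp hΩ b c p).le_opNorm ⟨v.1.1, hsub v.1.2⟩
  have h3 : ‖v‖ ≤ ‖(e.symm : L2 Ω →L[ℝ] HOutflow b)‖ * ‖p.fst‖ :=
    (e.symm : L2 Ω →L[ℝ] HOutflow b).le_opNorm _
  have h4 : ‖(⟨v.1.1, hsub v.1.2⟩ : HBroken b T)‖ = ‖v‖ := rfl
  rw [h1, h4, Real.norm_of_nonneg (sq_nonneg _)] at h2
  have h5 := h2.trans (mul_le_mul_of_nonneg_left h3 (norm_nonneg _))
  rcases (norm_nonneg p.fst).eq_or_lt with h6 | h6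
  · rw [← h6]; positivity
  · refine le_of_mul_le_mul_right ?_ h6
    linarith

/-! ### The stability constant and the inverse. -/

theorem sq_add_sq_le {u t a β κ N : ℝ} (hu0 : 0 ≤ u) (ht0 : 0 ≤ t) (ha0 : 0 ≤ a) (hβ0 : 0 ≤ β)
    (hκ0 : 0 ≤ κ) (hu : u ≤ (β * (1 + κ) + 1) * N) (ht : t ≤ β * (1 + κ) * N)
    (h : u ≤ a * N ∨ 1 ≤ a ∧ 1 ≤ β) :
    u ^ 2 + t ^ 2 ≤ (a ^ 2 + ((1 + a * (1 + κ)) * β * (κ + 1)) ^ 2) * N ^ 2 := by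
  set x := β * (1 + κ) with hx
  have hx0 : 0 ≤ x := mul_nonneg hβ0 (by linarith)
  have hC : (1 + a * (1 + κ)) * β * (κ + 1) = (1 + a * (1 + κ)) * x := by rw [hx]; ring
  rw [hC]
  have ht2 := pow_le_pow_left₀ ht0 ht 2
  rcases h with h | ⟨ha, hβ⟩
  · have h7 := pow_le_pow_left₀ hu0 h 2
    have h8 : x ≤ (1 + a * (1 + κ)) * x :=
      le_mul_of_one_le_left hx0 (by linarith [mul_nonneg ha0 (add_nonneg zero_le_one hκ0)])
    have h9 := mul_le_mul_of_nonneg_right (pow_le_pow_left₀ hx0 h8 2) (sq_nonneg N)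
    linarith
  · have hu2 := pow_le_pow_left₀ hu0 hu 2
    have hx1 : 1 ≤ x := one_le_mul_of_one_le_of_one_le hβ (by linarith)
    have ha1 : 1 ≤ a * (1 + κ) := one_le_mul_of_one_le_of_one_le ha (by linarith)
    have h8 : 2 * x ≤ (1 + a * (1 + κ)) * x := mul_le_mul_of_nonneg_right (by linarith) hx0
    have h9 := pow_le_pow_left₀ (by linarith) h8 2
    -- Since a ≥ 1, this reduces to x ≤ x²; the factor 2x comes from 1 + a(1 + κ) ≥ 2.
    have h10 : (x + 1) ^ 2 + x ^ 2 ≤ a ^ 2 + (2 * x) ^ 2 := by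
      linarith [one_le_pow₀ (n := 2) ha, mul_nonneg hx0 (sub_nonneg.2 hx1)]
    have h11 := mul_le_mul_of_nonneg_right (h10.trans (add_le_add_right h9 _)) (sq_nonneg N)
    linarith

theorem inverse_eq_symm {E F : Type*} [NormedAddCommGroup E] [NormedSpace ℝ E]
    [NormedAddCommGroup F] [NormedSpace ℝ F] {f : E →L[ℝ] F} {e : E ≃L[ℝ] F}
    (he : (e : E →L[ℝ] F) = f) : f.inverse = e.symm := by
  rw [← he, ContinuousLinearMap.inverse_equiv]

theorem injective_of_coe_eq {E F : Type*} [NormedAddCommGroup E] [NormedSpace ℝ E]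
    [NormedAddCommGroup F] [NormedSpace ℝ F] {f : E →L[ℝ] F} {e : E ≃L[ℝ] F}
    (he : (e : E →L[ℝ] F) = f) : Function.Injective f := by
  rw [← he]
  exact e.injective

theorem IsPartition.norm_le_dpgOp (hΩ : IsLipschitzDomain Ω) (hT : IsPartition Ω T)
    (e : HInflow b ≃L[ℝ] L2 Ω) (he : (e : HInflow b →L[ℝ] L2 Ω) = opB b c)
    (e' : HOutflow b ≃L[ℝ] L2 Ω) (he' : (e' : HOutflow b →L[ℝ] L2 Ω) = opBStar b c)
    (p : TrialSpace b T) :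
    ‖p‖ ≤ √(‖(e'.symm : L2 Ω →L[ℝ] HOutflow b)‖ ^ 2 +
      ((1 + ‖(e'.symm : L2 Ω →L[ℝ] HOutflow b)‖ * (1 + ‖c - b.div‖)) *
        ‖(e.symm : L2 Ω →L[ℝ] HInflow b)‖ * (‖c - b.div‖ + 1)) ^ 2) *
      ‖hT.dpgOp hΩ b c p‖ := by
  obtain ⟨q, hq, h1, h2⟩ := hT.exists_dpgOp_eq hΩ e he (hT.dpgOp hΩ b c p)
  obtain rfl := hT.dpgOp_injective hΩ (injective_of_coe_eq he) hq
  have hp : ‖q‖ ^ 2 = ‖q.fst‖ ^ 2 + ‖q.snd‖ ^ 2 := WithLp.prod_norm_sq_eq_of_L2 q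
  have hor : ‖q.fst‖ ≤ ‖(e'.symm : L2 Ω →L[ℝ] HOutflow b)‖ * ‖hT.dpgOp hΩ b c q‖ ∨
      1 ≤ ‖(e'.symm : L2 Ω →L[ℝ] HOutflow b)‖ ∧ 1 ≤ ‖(e.symm : L2 Ω →L[ℝ] HInflow b)‖ := by
    by_cases h0 : ∀ (φ : Pt n → ℝ) (hφ : IsTest Ω φ), (hφ.toGraph b).snd = 0
    · exact Or.inl (hT.norm_fst_le_of_boundaryForm_eq_zero hΩ
        (boundaryForm_eq_zero hΩ.isOpen h0) e' he' q)
    · push Not at h0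
      obtain ⟨φ, hφ, h0⟩ := h0
      exact Or.inr ⟨one_le_norm_opBStar_symm hΩ hφ h0 e' he', one_le_norm_opB_symm hΩ hφ h0 e he⟩
  have key := sq_add_sq_le (norm_nonneg _) (norm_nonneg _) (norm_nonneg _) (norm_nonneg _)
    (norm_nonneg _) h1 h2 hor
  refine abs_le_of_sq_le_sq' ?_ (mul_nonneg (Real.sqrt_nonneg _) (norm_nonneg _)) |>.2
  rw [mul_pow, Real.sq_sqrt (add_nonneg (sq_nonneg _) (sq_nonneg _)), hp]
  exact key

/-- The lower bound makes the algebraic inverse continuous, so no open mapping theorem and no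
completeness is involved. -/
theorem exists_continuousLinearEquiv {E F : Type*} [NormedAddCommGroup E] [NormedSpace ℝ E]
    [NormedAddCommGroup F] [NormedSpace ℝ F] (f : E →L[ℝ] F) (hf : Function.Bijective f) {C : ℝ}
    (hC0 : 0 ≤ C) (hC : ∀ x, ‖x‖ ≤ C * ‖f x‖) :
    ∃ e : E ≃L[ℝ] F, (∀ x, e x = f x) ∧ (e : E →L[ℝ] F) = f ∧ ‖(e.symm : F →L[ℝ] E)‖ ≤ C := by
  set l := LinearEquiv.ofBijective f.toLinearMap hf
  have hl : ∀ y, ‖l.symm y‖ ≤ C * ‖y‖ := fun y => by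
    have h1 := hC (l.symm y)
    have h2 : f (l.symm y) = y := l.apply_symm_apply y
    rwa [h2] at h1
  exact ⟨l.toContinuousLinearEquivOfBounds _ _ f.le_opNorm hl, fun _ => rfl, rfl,
    ContinuousLinearMap.opNorm_le_bound _ hC0 hl⟩

theorem IsPartition.exists_dpgEquiv (hΩ : IsLipschitzDomain Ω) (hT : IsPartition Ω T)
    (e : HInflow b ≃L[ℝ] L2 Ω) (he : (e : HInflow b →L[ℝ] L2 Ω) = opB b c)
    (e' : HOutflow b ≃L[ℝ] L2 Ω) (he' : (e' : HOutflow b →L[ℝ] L2 Ω) = opBStar b c) :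
    ∃ Bh : TrialSpace b T ≃L[ℝ] StrongDual ℝ (HBroken b T),
      (∀ p, Bh p = hT.dpgOp hΩ b c p) ∧
      (Bh : TrialSpace b T →L[ℝ] StrongDual ℝ (HBroken b T)) = hT.dpgOp hΩ b c ∧
      ‖(Bh.symm : StrongDual ℝ (HBroken b T) →L[ℝ] TrialSpace b T)‖ ≤
        √(‖(e'.symm : L2 Ω →L[ℝ] HOutflow b)‖ ^ 2 +
          ((1 + ‖(e'.symm : L2 Ω →L[ℝ] HOutflow b)‖ * (1 + ‖c - b.div‖)) *
            ‖(e.symm : L2 Ω →L[ℝ] HInflow b)‖ * (‖c - b.div‖ + 1)) ^ 2) :=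
  exists_continuousLinearEquiv (hT.dpgOp hΩ b c)
    ⟨hT.dpgOp_injective hΩ (injective_of_coe_eq he),
      fun F => (hT.exists_dpgOp_eq hΩ e he F).imp fun _ h => h.1⟩
    (Real.sqrt_nonneg _) (hT.norm_le_dpgOp hΩ e he e' he')

end Transport
end

open Transport
theorem theorem3 {n : ℕ} {Ω : Set (Pt n)} (hΩ : IsLipschitzDomain Ω)
    (b : DivField Ω) (c : LInf Ω)
    (hB : (opB b c).IsInvertible) (hBStar : (opBStar b c).IsInvertible)
    {T : Set (Set (Pt n))} (hT : IsPartition Ω T) :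
    ∃ Bh : TrialSpace b T ≃L[ℝ] StrongDual ℝ (HBroken b T),
      (∀ (p : TrialSpace b T) (v : HBroken b T), Bh p v = dpgForm b c T p v) ∧
      ‖(Bh : TrialSpace b T →L[ℝ] StrongDual ℝ (HBroken b T))‖ ≤
        2 + ‖b.div‖ + ‖c - b.div‖ ∧
      ‖(Bh.symm : StrongDual ℝ (HBroken b T) →L[ℝ] TrialSpace b T)‖ ≤
        √(‖(opBStar b c).inverse‖ ^ 2 +
          ((1 + ‖(opBStar b c).inverse‖ * (1 + ‖c - b.div‖)) *
            ‖(opB b c).inverse‖ * (‖c - b.div‖ + 1)) ^ 2) := by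
  obtain ⟨e, he⟩ := hB
  obtain ⟨e', he'⟩ := hBStar
  obtain ⟨Bh, hBh, hBh', hsymm⟩ := hT.exists_dpgEquiv hΩ e he e' he'
  refine ⟨Bh, fun p v => DFunLike.congr_fun (hBh p) v, ?_, ?_⟩
  · rw [hBh']; exact hT.norm_dpgOp_le hΩ
  · rw [inverse_eq_symm he, inverse_eq_symm he']
    exact hsymm
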